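/- Let $\ell$ be a prime with $\ell\neq 2$, let $G$ be a finite group, let $\rho\colon G\to \mathrm{GL}_2(\overline{\mathbb F}_\ell)$ be an absolutely irreducible representation, and let $\mu\colon G\to\overline{\mathbb F}_\ell^\times$ be a character of even order. Let $\mathrm{ad}^0\rho$ be the space of trace-zero $2\times 2$ matrices over $\overline{\mathbb F}_\ell$, on which $g\in G$ acts by $X\mapsto\rho(g)X\rho(g)^{-1}$. Let $N=\ker(\mathrm{ad}^0\rho\otimes\mu)\cap\ker\mu$, which is the same subgroup as $\ker(\mathrm{ad}^0\rho)\cap\ker\mu$. Then $$H^1\bigl(G/N,\ \mathrm{ad}^0\rho\otimes\mu\bigr)=0,$$ except possibly when $\ell=5$, the projective image of $\rho$ (the image of $G$ in $\mathrm{PGL}_2(\overline{\mathbb F}_5)$) is isomorphic to $\mathrm{PGL}_2(\mathbb F_5)$, and $\mu$ factors through the character of order $2$ of $\mathrm{PGL}_2(\mathbb F_5)$, that is, $\mu$ is the composite of $G\to\mathrm{PGL}_2(\mathbb F_5)$ with that character. -/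

import Mathlib

noncomputable section

namespace AdjointH1

open Matrix

/-- The `G`-representation on column vectors `k²` attached to a homomorphism `G → GL₂(k)`. -/
def vecRep {k G : Type*} [Field k] [Group G] (ρ : G →* GL (Fin 2) k) :
    Representation k G (Fin 2 → k) where
  toFun g := Matrix.mulVecLin (ρ g : Matrix (Fin 2) (Fin 2) k)
  map_one' := by simp [Module.End.one_eq_id]
  map_mul' g h := by simp [Matrix.mulVecLin_mul, Module.End.mul_eq_comp]

/-- `ρ` is absolutely irreducible: it is irreducible after every extension of the base field. -/
def IsAbsolutelyIrreducible {k : Type} {G : Type*} [Field k] [Group G]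
    (ρ : G →* GL (Fin 2) k) : Prop :=
  ∀ (K : Type) [Field K] [Algebra k K],
    (vecRep ((Matrix.GeneralLinearGroup.map (algebraMap k K)).comp ρ)).IsIrreducible

/-- The space of trace-zero `2 × 2` matrices, which underlies `ad⁰`. -/
abbrev TraceZero (k : Type*) [Field k] : Submodule k (Matrix (Fin 2) (Fin 2) k) :=
  LinearMap.ker (Matrix.traceLinearMap (Fin 2) k k)

/-- Conjugation `X ↦ A X A⁻¹` on trace-zero matrices. -/
def conj {k : Type*} [Field k] (A : GL (Fin 2) k) : TraceZero k →ₗ[k] TraceZero k where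
  toFun X := ⟨(A : Matrix (Fin 2) (Fin 2) k) * X.1 * ((A⁻¹ : GL (Fin 2) k) : Matrix _ _ k), by
    have h := X.2
    simp only [LinearMap.mem_ker, Matrix.traceLinearMap_apply] at h ⊢
    rw [Matrix.trace_mul_comm, ← mul_assoc, ← Units.val_mul, inv_mul_cancel, Units.val_one,
      one_mul, h]⟩
  map_add' X Y := by ext1; simp [mul_add, add_mul]
  map_smul' c X := by ext1; simp

/-- The adjoint representation `ad⁰ ρ` on trace-zero matrices: `g` acts by conjugation by
`ρ(g)`. -/
def adZero {k G : Type*} [Field k] [Group G] (ρ : G →* GL (Fin 2) k) :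
    Representation k G (TraceZero k) where
  toFun g := conj (ρ g)
  map_one' := by ext1 X; ext1; simp [conj]
  map_mul' g h := by ext1 X; ext1; simp [conj, mul_assoc]

/-- The twist `σ ⊗ μ` of a representation by a character: `g` acts as `μ(g) • σ(g)`. -/
def twist {k G V : Type*} [Field k] [Group G] [AddCommGroup V] [Module k V]
    (σ : Representation k G V) (μ : G →* kˣ) : Representation k G V where
  toFun g := (μ g : k) • σ g
  map_one' := by simp
  map_mul' g h := by
    rw [map_mul, map_mul, Units.val_mul, smul_mul_smul_comm]

/-- The normal subgroup `ker(ad⁰ρ ⊗ μ) ∩ ker μ`. -/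
def kernel {k G : Type*} [Field k] [Group G] (ρ : G →* GL (Fin 2) k) (μ : G →* kˣ) :
    Subgroup G :=
  (twist (adZero ρ) μ).ker ⊓ μ.ker

/-- This is the same subgroup as `ker(ad⁰ρ) ∩ ker μ`. -/
theorem kernel_eq {k G : Type*} [Field k] [Group G] (ρ : G →* GL (Fin 2) k) (μ : G →* kˣ) :
    kernel ρ μ = (adZero ρ).ker ⊓ μ.ker := by
  ext g
  simp only [kernel, Subgroup.mem_inf, MonoidHom.mem_ker]
  refine and_congr_left fun h => ?_
  simp [twist, h]

instance {k G : Type*} [Field k] [Group G] (ρ : G →* GL (Fin 2) k) (μ : G →* kˣ) :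
    (kernel ρ μ).Normal := by
  unfold kernel; infer_instance

/-- `ad⁰ρ ⊗ μ` as a representation of `G / (ker(ad⁰ρ ⊗ μ) ∩ ker μ)`. -/
def quotientRep {k G : Type*} [Field k] [Group G] (ρ : G →* GL (Fin 2) k) (μ : G →* kˣ) :
    Representation k (G ⧸ kernel ρ μ) (TraceZero k) :=
  QuotientGroup.lift (kernel ρ μ) (twist (adZero ρ) μ) fun _ hg => hg.1

/-- The composite of `ρ` with `GL₂(k) → PGL₂(k)`; its range is the projective image of `ρ`. -/
def projective {k G : Type*} [Field k] [Group G] (ρ : G →* GL (Fin 2) k) :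
    G →* ProjGenLinGroup (Fin 2) k :=
  ProjGenLinGroup.mk.comp ρ

/-- The exceptional case: `ℓ = 5`, the projective image of `ρ` is isomorphic to `PGL₂(𝔽₅)`, and
`μ` is the composite of `G → PGL₂(𝔽₅)` with the character of order `2` of `PGL₂(𝔽₅)`. -/
def IsExceptional {k G : Type*} [Field k] [Group G] (ℓ : ℕ)
    (ρ : G →* GL (Fin 2) k) (μ : G →* kˣ) : Prop :=
  ℓ = 5 ∧ ∃ (e : (projective ρ).range ≃* ProjGenLinGroup (Fin 2) (ZMod 5))
    (χ : ProjGenLinGroup (Fin 2) (ZMod 5) →* kˣ),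
    orderOf χ = 2 ∧ ∀ g : G, μ g = χ (e ((projective ρ).rangeRestrict g))

end AdjointH1

end

/-! Suppose first that some z with scalar ρ(z) has μ(z) ≠ 1. Then z is central modulo N and acts on
the coefficients by a scalar other than 1, so the cohomology vanishes. Otherwise cocycles can be
read on the projective image Γ ⊂ PGL₂(k), a finite group without fixed point on the projective line,
and μ becomes a character of Γ taking the value -1.

If ℓ does not divide |Γ|, averaging suffices. If it does, a Sylow ℓ-subgroup and its normalizer fix
a common point, placed at ∞. By the Frattini argument, μ takes the value -1 on some affine element,
a power of which is an involution, placed at s : x ↦ -x. Let A be the group of translations in Γ and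
D the group of linear parts of its affine elements, with A scaled to contain 1. Counting pairs
(conjugate of s, fixed point in the orbit of ∞) shows that this orbit is A ∪ {∞} and that D = A \
{0} (`orbit_eq`). No classification of the finite subgroups of PGL₂ is needed.

Now normalize a cocycle to vanish on the maps x ↦ tx, whose number is prime to ℓ. On translations it
becomes three functions on A, equivariant under D up to sign (`translation_cocycle`). They form a
coboundary unless μ(x ↦ tx) = t² on D. In that case D consists of fourth roots of unity, and
additivity of A gives 5 = 0 and Γ ≅ PGL₂(𝔽₅). A cocycle that is a coboundary on the Sylow subgroup
is one on Γ, since the index is prime to ℓ. -/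

noncomputable section

namespace AdjointH1

open Matrix OnePoint
open scoped MatrixGroups

/-! ### Affine maps and inversions in PGL₂. -/

variable {k : Type*} [Field k]

/-- The affine transformation `x ↦ t x + a` as an element of `PGL₂(k)`. -/
def aff (t : kˣ) (a : k) : PGL(2, k) :=
  ProjGenLinGroup.mk (GeneralLinearGroup.mkOfDetNeZero !![(t : k), a; 0, 1] (by simp))

theorem mk_eq_mk_of_smul {g h : GL (Fin 2) k} (z : k)
    (H : (g : Matrix (Fin 2) (Fin 2) k) = z • (h : Matrix (Fin 2) (Fin 2) k)) :
    (ProjGenLinGroup.mk g : PGL(2, k)) = ProjGenLinGroup.mk h := by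
  have hz : z ≠ 0 := by
    rintro rfl
    apply g.det_ne_zero
    rw [H]; simp
  symm
  rw [ProjGenLinGroup.mk_eq_mk_iff]
  refine ⟨Units.mk0 z hz, ?_⟩
  ext i j
  rw [H]
  fin_cases i <;> fin_cases j <;> simp [Matrix.mul_apply, mul_comm]

theorem exists_smul_of_mk_eq_mk {g h : GL (Fin 2) k}
    (H : (ProjGenLinGroup.mk g : PGL(2, k)) = ProjGenLinGroup.mk h) :
    ∃ z : k, z ≠ 0 ∧
      (h : Matrix (Fin 2) (Fin 2) k) = z • (g : Matrix (Fin 2) (Fin 2) k) := by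
  obtain ⟨u, hu⟩ := ProjGenLinGroup.mk_eq_mk_iff.1 H
  refine ⟨u, u.ne_zero, ?_⟩
  rw [← hu]
  ext i j
  fin_cases i <;> fin_cases j <;> simp [Matrix.mul_apply, mul_comm]

theorem aff_mul (t t' : kˣ) (a a' : k) : aff t a * aff t' a' = aff (t * t') (t * a' + a) := by
  unfold aff
  rw [← map_mul]
  congr 1
  ext i j
  fin_cases i <;> fin_cases j <;> simp [GeneralLinearGroup.mkOfDetNeZero]

@[simp]
theorem aff_one_zero : aff (1 : kˣ) 0 = 1 := by
  unfold aff
  rw [← map_one ProjGenLinGroup.mk]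
  congr 1
  ext i j
  fin_cases i <;> fin_cases j <;> simp [GeneralLinearGroup.mkOfDetNeZero]

theorem aff_inv (t : kˣ) (a : k) : (aff t a)⁻¹ = aff t⁻¹ (-((t⁻¹ : kˣ) : k) * a) := by
  rw [inv_eq_iff_mul_eq_one, aff_mul]
  simp

theorem aff_inj {t t' : kˣ} {a a' : k} : aff t a = aff t' a' ↔ t = t' ∧ a = a' := by
  refine ⟨fun h => ?_, fun h => by rw [h.1, h.2]⟩
  obtain ⟨z, -, hz⟩ := exists_smul_of_mk_eq_mk h
  have h1 := congrFun (congrFun hz 1) 1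
  have h2 := congrFun (congrFun hz 0) 0
  have h3 := congrFun (congrFun hz 0) 1
  simp [GeneralLinearGroup.mkOfDetNeZero] at h1 h2 h3
  subst h1
  simp at h2 h3
  exact ⟨Units.ext h2.symm, h3.symm⟩

theorem aff_pow (t : kˣ) (a : k) (n : ℕ) : ∃ b, aff t a ^ n = aff (t ^ n) b := by
  induction n with
  | zero => exact ⟨0, by simp⟩
  | succ n ih =>
    obtain ⟨b, hb⟩ := ih
    exact ⟨_, by rw [pow_succ, hb, aff_mul, pow_succ]⟩

theorem aff_conj_translation (t : kˣ) (a b : k) :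
    aff t a * aff 1 b * (aff t a)⁻¹ = aff 1 (t * b) := by
  rw [aff_inv, aff_mul, aff_mul, aff_inj]
  simp

/-- The Möbius transformation `x ↦ c / x`. -/
def inversion (c : kˣ) : PGL(2, k) :=
  ProjGenLinGroup.mk (GeneralLinearGroup.mkOfDetNeZero !![0, (c : k); 1, 0] (by simp))

theorem inversion_mul_aff (c t : kˣ) :
    inversion c * aff t 0 = aff t⁻¹ 0 * inversion c := by
  unfold inversion aff
  rw [← map_mul, ← map_mul]
  refine mk_eq_mk_of_smul (t : k) ?_
  ext i j
  fin_cases i <;> fin_cases j <;> simp [GeneralLinearGroup.mkOfDetNeZero]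

/-! ### Möbius action on the projective line. -/

section Action

variable [DecidableEq k]

/-- The action of `PGL₂(k)` on the projective line by Möbius transformations. -/
instance projAction : MulAction PGL(2, k) (OnePoint k) :=
  ProjGenLinGroup.mulActionOfGL (by
    intro u a
    cases a with
    | infty => simp [smul_infty_eq_ite]
    | coe c => simp [smul_some_eq_ite])

theorem projMk_smul (g : GL (Fin 2) k) (x : OnePoint k) :
    (ProjGenLinGroup.mk g : PGL(2, k)) • x = g • x := rfl

@[simp]
theorem aff_smul_infty (t : kˣ) (a : k) : aff t a • (∞ : OnePoint k) = ∞ := by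
  simp [aff, projMk_smul, smul_infty_eq_ite, GeneralLinearGroup.mkOfDetNeZero]

@[simp]
theorem aff_smul_coe (t : kˣ) (a x : k) :
    aff t a • (x : OnePoint k) = ((t * x + a : k) : OnePoint k) := by
  simp [aff, projMk_smul, smul_some_eq_ite, GeneralLinearGroup.mkOfDetNeZero]

theorem exists_eq_aff {p : PGL(2, k)} (hp : p • (∞ : OnePoint k) = ∞) :
    ∃ t a, p = aff t a := by
  induction p using ProjGenLinGroup.induction_on with | mk g =>
  rw [projMk_smul, smul_infty_eq_self_iff] at hp
  have hd := g.det_ne_zero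
  rw [det_fin_two, hp] at hd
  have h0 : g 0 0 ≠ 0 := fun h => hd (by simp [h])
  have h1 : g 1 1 ≠ 0 := fun h => hd (by simp [h])
  refine ⟨Units.mk0 (g 0 0 / g 1 1) (div_ne_zero h0 h1), g 0 1 / g 1 1,
    mk_eq_mk_of_smul (g 1 1) ?_⟩
  ext i j
  fin_cases i <;> fin_cases j <;>
    simp [GeneralLinearGroup.mkOfDetNeZero, mul_div_cancel₀ _ h1, hp]

theorem exists_smul_infty_eq (x : OnePoint k) : ∃ p : PGL(2, k), p • (∞ : OnePoint k) = x := by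
  cases x with
  | infty => exact ⟨1, one_smul _ _⟩
  | coe c =>
    refine ⟨ProjGenLinGroup.mk (GeneralLinearGroup.mkOfDetNeZero !![c, -1; 1, 0] (by simp)), ?_⟩
    simp [projMk_smul, smul_infty_eq_ite, GeneralLinearGroup.mkOfDetNeZero]

theorem exists_eq_inversion {p : PGL(2, k)} (h : p • (∞ : OnePoint k) = ((0 : k) : OnePoint k))
    (h' : p • ((0 : k) : OnePoint k) = ∞) : ∃ c, p = inversion c := by
  induction p using ProjGenLinGroup.induction_on with | mk g =>
  rw [projMk_smul, smul_infty_eq_ite] at h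
  rw [projMk_smul, smul_some_eq_ite] at h'
  have h10 : g 1 0 ≠ 0 := by
    intro H; simp [H] at h
  have h00 : g 0 0 = 0 := by
    rw [if_neg h10] at h
    simpa [h10, OnePoint.coe_eq_coe] using h
  have h11 : g 1 1 = 0 := by
    by_contra H
    simp [H] at h'
  have hd := g.det_ne_zero
  rw [det_fin_two, h00, h11] at hd
  have h01 : g 0 1 ≠ 0 := fun h => hd (by simp [h])
  refine ⟨Units.mk0 (g 0 1 / g 1 0) (div_ne_zero h01 h10), mk_eq_mk_of_smul (g 1 0) ?_⟩
  ext i j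
  fin_cases i <;> fin_cases j <;>
    simp [GeneralLinearGroup.mkOfDetNeZero, mul_div_cancel₀ _ h10, h00, h11]

theorem inversion_smul_coe (c : kˣ) {x : k} (hx : x ≠ 0) :
    inversion c • (x : OnePoint k) = ((c / x : k) : OnePoint k) := by
  simp [inversion, projMk_smul, smul_some_eq_ite, GeneralLinearGroup.mkOfDetNeZero, hx]

theorem inversion_smul_zero (c : kˣ) :
    inversion c • ((0 : k) : OnePoint k) = ∞ := by
  simp [inversion, projMk_smul, smul_some_eq_ite, GeneralLinearGroup.mkOfDetNeZero]

end Action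

/-! ### The adjoint representation in coordinates. -/

/-- The conjugation action of `PGL₂(k)` on trace-zero matrices. -/
def adj : Representation k PGL(2, k) (TraceZero k) :=
  ProjGenLinGroup.lift (adZero (MonoidHom.id (GL (Fin 2) k))) (by
    ext u X i j
    simp only [MonoidHom.comp_apply, MonoidHom.one_apply]
    have : conj (GeneralLinearGroup.scalar (Fin 2) u) X = X := by
      ext1
      have h : (u : k) * ((u⁻¹ : kˣ) : k) = 1 := by simp
      simp [conj, ← map_inv, ← smul_eq_mul_diagonal, ← smul_eq_diagonal_mul, smul_smul]
    exact congrFun (congrFun (congrArg Subtype.val this) i) j)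

theorem adj_mk (g : GL (Fin 2) k) : adj (ProjGenLinGroup.mk g) = conj g := rfl

theorem traceZero_apply_one_one (X : TraceZero k) : X.1 1 1 = - X.1 0 0 := by
  have h := X.2
  simp only [LinearMap.mem_ker, Matrix.traceLinearMap_apply, trace_fin_two] at h
  linear_combination h

/-- The trace-zero matrix with entries `p, q, r, -p`. -/
def tz (p q r : k) : TraceZero k :=
  ⟨!![p, q; r, -p], by simp [Matrix.traceLinearMap_apply, trace_fin_two]⟩

theorem traceZero_eq_tz (X : TraceZero k) : X = tz (X.1 0 0) (X.1 0 1) (X.1 1 0) := by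
  ext i j
  fin_cases i <;> fin_cases j <;> simp [tz, traceZero_apply_one_one]

theorem tz_inj {p q r p' q' r' : k} : tz p q r = tz p' q' r' ↔ p = p' ∧ q = q' ∧ r = r' := by
  refine ⟨fun h => ?_, fun h => by rw [h.1, h.2.1, h.2.2]⟩
  have h : (tz p q r).1 = (tz p' q' r').1 := congrArg _ h
  refine ⟨?_, ?_, ?_⟩
  · simpa [tz] using congrFun (congrFun h 0) 0
  · simpa [tz] using congrFun (congrFun h 0) 1
  · simpa [tz] using congrFun (congrFun h 1) 0

theorem tz_sub (p q r p' q' r' : k) : tz p q r - tz p' q' r' = tz (p - p') (q - q') (r - r') := by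
  ext i j
  fin_cases i <;> fin_cases j <;> simp [tz]; ring

theorem smul_tz (c p q r : k) : c • tz p q r = tz (c * p) (c * q) (c * r) := by
  ext i j
  fin_cases i <;> fin_cases j <;> simp [tz]

theorem adj_aff (t : kˣ) (a p q r : k) :
    adj (aff t a) (tz p q r) =
      tz (p + t⁻¹ * a * r) (t * q - 2 * a * p - t⁻¹ * a ^ 2 * r) (t⁻¹ * r) := by
  rw [aff, adj_mk]
  have ht : (t : k) * ((t : k))⁻¹ = 1 := by simp
  ext i j
  fin_cases i <;> fin_cases j <;>
    (simp [tz, conj, GeneralLinearGroup.mkOfDetNeZero, Matrix.inv_def, adjugate_fin_two]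
     field_simp
     try ring)

/-! ### Averaging of cocycles. -/

/-- A `1`-cocycle of a finite group that vanishes on a subgroup of invertible index is a
coboundary. -/
theorem exists_coboundary_of_vanish {k Γ V : Type*} [Field k] [Group Γ] [Finite Γ]
    [AddCommGroup V] [Module k V] (σ : Representation k Γ V) (c : Γ → V)
    (hc : ∀ g h, c (g * h) = c g + σ g (c h)) (H : Subgroup Γ) (hH : ∀ h ∈ H, c h = 0)
    (hi : (H.index : k) ≠ 0) : ∃ v, ∀ g, c g = σ g v - v := by
  classical
  have : Fintype (Γ ⧸ H) := Fintype.ofFinite _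
  have hl : ∀ a b : Γ, (QuotientGroup.leftRel H) a b → c a = c b := by
    intro a b hab
    rw [QuotientGroup.leftRel_apply] at hab
    have := hc a (a⁻¹ * b)
    rw [hH _ hab, mul_inv_cancel_left] at this
    simpa using this.symm
  -- The cocycle is constant on left cosets of H. Reindexing its sum S over Γ/H by g gives S = [Γ:H]
  -- c(g) + gS.
  let f : Γ ⧸ H → V := Quotient.lift c hl
  have hf : ∀ (g : Γ) (x : Γ ⧸ H), f (g • x) = c g + σ g (f x) := by
    intro g x
    induction x using QuotientGroup.induction_on with | H z => exact hc g z
  set S := ∑ x, f x with hS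
  have key : ∀ g, S = (H.index : k) • c g + σ g S := by
    intro g
    have h1 : S = ∑ x : Γ ⧸ H, f (g • x) :=
      (Equiv.sum_comp (MulAction.toPerm g : Equiv.Perm (Γ ⧸ H)) f).symm
    rw [hS, map_sum, Nat.cast_smul_eq_nsmul, Subgroup.index, Nat.card_eq_fintype_card,
      ← Finset.card_univ, ← Finset.sum_const, ← Finset.sum_add_distrib, ← hS, h1]
    exact Finset.sum_congr rfl fun x _ => hf g x
  refine ⟨-((H.index : k)⁻¹ • S), fun g => ?_⟩
  have := key g
  rw [map_neg, _root_.map_smul, sub_neg_eq_add, neg_add_eq_sub, ← smul_sub]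
  nth_rewrite 1 [this]
  rw [add_sub_cancel_right, smul_smul, inv_mul_cancel₀ hi, one_smul]

theorem cocycle_one {k Γ V : Type*} [Field k] [Group Γ]
    [AddCommGroup V] [Module k V] (σ : Representation k Γ V) (c : Γ → V)
    (hc : ∀ g h, c (g * h) = c g + σ g (c h)) : c 1 = 0 := by
  simpa using hc 1 1

theorem exists_coboundary_on_of_card {k Γ V : Type*} [Field k] [Group Γ] [Finite Γ]
    [AddCommGroup V] [Module k V] (σ : Representation k Γ V) (c : Γ → V)
    (hc : ∀ g h, c (g * h) = c g + σ g (c h)) (T : Subgroup Γ)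
    (hi : (Nat.card T : k) ≠ 0) : ∃ v, ∀ g ∈ T, c g = σ g v - v := by
  obtain ⟨v, hv⟩ := exists_coboundary_of_vanish (σ.comp T.subtype) (fun g => c g)
    (fun g h => hc g h) ⊥ (by
      intro h hh
      rw [Subgroup.mem_bot] at hh
      subst hh
      exact cocycle_one σ c hc) (by simpa using hi)
  exact ⟨v, fun g hg => hv ⟨g, hg⟩⟩

theorem cocycle_sub_coboundary {k Γ V : Type*} [Field k] [Group Γ]
    [AddCommGroup V] [Module k V] (σ : Representation k Γ V) (c : Γ → V)
    (hc : ∀ g h, c (g * h) = c g + σ g (c h)) (v : V) (g h : Γ) :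
    c (g * h) - (σ (g * h) v - v) = c g - (σ g v - v) + σ g (c h - (σ h v - v)) := by
  rw [hc, map_mul, Module.End.mul_apply, map_sub, map_sub]
  abel

/-- In characteristic ℓ, x^(ℓⁿ) - 1 = (x - 1)^(ℓⁿ). Hence characters kill ℓ-elements, and affine
ℓ-elements are translations. -/
theorem unit_eq_one_of_pow {k : Type*} [Field k] {ℓ : ℕ} [Fact ℓ.Prime] [CharP k ℓ]
    (t : kˣ) {n : ℕ} (h : t ^ ℓ ^ n = 1) : t = 1 := by
  have : (t : k) ^ ℓ ^ n = 1 := by rw [← Units.val_pow_eq_pow_val, h, Units.val_one]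
  ext
  have h2 : ((t : k) - 1) ^ ℓ ^ n = 0 := by
    rw [sub_pow_char_pow, this]; simp
  exact sub_eq_zero.1 (eq_zero_of_pow_eq_zero h2)

/-! ### Fixed points of ℓ-elements. -/

section FixedPoints

variable {k : Type*} [Field k] [DecidableEq k]

theorem exists_fixed_point [IsAlgClosed k] (p : PGL(2, k)) : ∃ x : OnePoint k, p • x = x := by
  induction p using ProjGenLinGroup.induction_on with | mk g =>
  by_cases h : g 1 0 = 0
  · exact ⟨∞, by rw [projMk_smul, smul_infty_eq_self_iff, h]⟩
  · obtain ⟨c, hc⟩ := IsAlgClosed.exists_aeval_eq_zero k g.fixpointPolynomial (by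
      rw [GeneralLinearGroup.fixpointPolynomial]
      have : (Polynomial.C (g 1 0) * Polynomial.X ^ 2 +
          Polynomial.C (g 1 1 - g 0 0) * Polynomial.X + Polynomial.C (- g 0 1)).degree ≠ 0 := by
        rw [Polynomial.degree_quadratic h]; decide
      rwa [map_neg, ← sub_eq_add_neg] at this)
    exact ⟨c, by rwa [projMk_smul, ← GeneralLinearGroup.fixpointPolynomial_aeval_eq_zero_iff]⟩

variable {ℓ : ℕ} [Fact ℓ.Prime] [CharP k ℓ]

theorem exists_translation_of_pow {p : PGL(2, k)} {n : ℕ} (hp : p ^ ℓ ^ n = 1)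
    (hfix : p • (∞ : OnePoint k) = ∞) : ∃ a, p = aff 1 a := by
  obtain ⟨t, a, rfl⟩ := exists_eq_aff hfix
  obtain ⟨b, hb⟩ := aff_pow t a (ℓ ^ n)
  rw [hp, ← aff_one_zero, aff_inj] at hb
  exact ⟨a, by rw [unit_eq_one_of_pow t hb.1.symm]⟩

theorem eq_infty_of_translation_fix {a : k} (ha : a ≠ 0) {x : OnePoint k}
    (hx : aff 1 a • x = x) : x = ∞ := by
  cases x with
  | infty => rfl
  | coe c =>
    rw [aff_smul_coe, OnePoint.coe_eq_coe] at hx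
    simp [ha] at hx

/-- With x moved to ∞, the element becomes a nonzero translation, which fixes no finite point. -/
theorem unique_fixed_point {p : PGL(2, k)} {n : ℕ} (hp : p ^ ℓ ^ n = 1) (hp1 : p ≠ 1)
    {x y : OnePoint k} (hx : p • x = x) (hy : p • y = y) : x = y := by
  obtain ⟨g, rfl⟩ := exists_smul_infty_eq x
  have h1 : (g⁻¹ * p * g) ^ ℓ ^ n = 1 := by
    have := conj_pow (a := g⁻¹) (b := p) (i := ℓ ^ n)
    rw [inv_inv] at this
    rw [this, hp]; simp
  obtain ⟨a, ha⟩ := exists_translation_of_pow h1 (by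
    rw [mul_smul, mul_smul, hx, inv_smul_smul])
  have ha0 : a ≠ 0 := by
    rintro rfl
    rw [aff_one_zero] at ha
    apply hp1
    have : p = g * (g⁻¹ * p * g) * g⁻¹ := by group
    rw [this, ha]; simp
  have := eq_infty_of_translation_fix ha0 (x := g⁻¹ • y) (by
    rw [← ha, mul_smul, mul_smul, smul_inv_smul, hy])
  rw [← this, smul_inv_smul]

/-- A nontrivial Sylow `ℓ`-subgroup of a finite subgroup of `PGL₂(k)` fixes a point of the
projective line that is also fixed by its normalizer. -/
theorem exists_fixed_by_normalizer [IsAlgClosed k] {Γ : Type*} [Group Γ] [Finite Γ]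
    (π : Γ →* PGL(2, k)) (hπ : Function.Injective π) (U : Sylow ℓ Γ) (hU : Nontrivial U) :
    ∃ x : OnePoint k, ∀ g ∈ Subgroup.normalizer (U : Set Γ), π g • x = x := by
  have hp := U.isPGroup'
  -- Let z ≠ 1 be central in U. All of U preserves the unique fixed point x of z. If g normalizes U,
  -- then g⁻¹zg ∈ U fixes x, so z fixes gx and gx = x.
  have := hp.center_nontrivial
  obtain ⟨⟨z, hz⟩, hz1⟩ := exists_ne (1 : Subgroup.center U)
  have hz1 : (z : Γ) ≠ 1 := by
    intro h; apply hz1; ext; simpa using h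
  obtain ⟨n, hn⟩ := hp z
  have hpz : π z ^ ℓ ^ n = 1 := by
    rw [← map_pow, ← map_one π]
    congr 1
    exact congrArg Subtype.val hn
  have hpz1 : π z ≠ 1 := by
    rw [← map_one π]; exact fun h => hz1 (hπ h)
  obtain ⟨x, hx⟩ := exists_fixed_point (π z)
  have hUx : ∀ u : U, π u • x = x := by
    intro u
    refine unique_fixed_point hpz hpz1 ?_ hx
    have hcomm : (z : Γ) * u = u * z := by
      have := Subgroup.mem_center_iff.1 hz u
      exact (congrArg Subtype.val this).symm
    rw [← mul_smul, ← map_mul, hcomm, map_mul, mul_smul, hx]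
  refine ⟨x, fun g hg => ?_⟩
  refine unique_fixed_point hpz hpz1 ?_ hx
  have hmem : g⁻¹ * z * g ∈ (U : Set Γ) := by
    have := (Subgroup.mem_normalizer_iff.1 (inv_mem hg) z).1 z.2
    simp only [inv_inv] at this
    exact this
  have := hUx ⟨_, hmem⟩
  simp only [map_mul, map_inv, mul_smul] at this
  rwa [inv_smul_eq_iff] at this

end FixedPoints

/-! ### Values of characters. -/

/-- Frattini argument: a character with values in `kˣ` takes all its values on the normalizer of a
Sylow `ℓ`-subgroup. -/
theorem exists_mem_normalizer_char_eq {k Γ : Type*} [Field k] {ℓ : ℕ} [Fact ℓ.Prime]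
    [CharP k ℓ] [Group Γ] [Finite Γ] (μ : Γ →* kˣ)
    (U : Sylow ℓ Γ) (g : Γ) : ∃ b ∈ Subgroup.normalizer (U : Set Γ), μ g = μ b := by
  have hle : (U : Subgroup Γ) ≤ μ.ker := by
    intro u hu
    obtain ⟨n, hn⟩ := U.isPGroup' ⟨u, hu⟩
    rw [MonoidHom.mem_ker]
    apply unit_eq_one_of_pow (ℓ := ℓ) (n := n)
    rw [← map_pow]
    have : u ^ ℓ ^ n = 1 := congrArg Subtype.val hn
    rw [this, map_one]
  have h := Sylow.normalizer_sup_eq_top' U hle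
  have hg : g ∈ Subgroup.normalizer (U : Set Γ) ⊔ μ.ker := by rw [h]; trivial
  obtain ⟨b, hb, κ, hκ, rfl⟩ := Subgroup.mem_sup_of_normal_right.1 hg
  refine ⟨b, hb, ?_⟩
  rw [map_mul, MonoidHom.mem_ker.1 hκ, mul_one]

/-- A character of even order takes the value `-1`. -/
theorem exists_char_eq_neg_one {k Γ : Type*} [Field k] [Group Γ] [Finite Γ] (μ : Γ →* kˣ)
    (hμ : Even (orderOf μ)) : ∃ g, μ g = -1 := by
  obtain ⟨d, hd⟩ := even_iff_exists_two_mul.1 hμ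
  have hpos : 0 < orderOf μ := by
    refine orderOf_pos_iff.2 (isOfFinOrder_iff_pow_eq_one.2 ⟨Nat.card Γ, Nat.card_pos, ?_⟩)
    ext g
    rw [MonoidHom.pow_apply, ← map_pow, pow_card_eq_one']
    simp
  obtain ⟨g, hg⟩ : ∃ g, μ g ^ d ≠ 1 := by
    by_contra! H
    have h1 : orderOf μ ∣ d := orderOf_dvd_of_pow_eq_one (MonoidHom.ext H)
    have h2 := Nat.le_of_dvd (by omega) h1
    omega
  have h1 : μ g ^ (2 * d) = 1 := by
    have : μ ^ orderOf μ = 1 := pow_orderOf_eq_one μ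
    rw [← hd]
    exact DFunLike.congr_fun this g
  refine ⟨g ^ d, ?_⟩
  rw [map_pow]
  have h2 : ((μ g ^ d : kˣ) : k) ^ 2 = 1 := by
    rw [← Units.val_pow_eq_pow_val, ← pow_mul, mul_comm d 2, h1, Units.val_one]
  rcases mul_self_eq_one_iff.1 ((sq _).symm.trans h2) with h | h
  · exact absurd (Units.ext h) hg
  · exact Units.ext h

/-! ### Translations and linear parts. -/

section Counting

variable {k : Type*} [Field k] {Γ : Type*} [Group Γ]

/-- The translations contained in a group of Möbius transformations. -/
def transl (π : Γ →* PGL(2, k)) : AddSubgroup k where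
  carrier := {a | ∃ g, π g = aff 1 a}
  zero_mem' := ⟨1, by simp⟩
  add_mem' := by
    rintro a b ⟨g, hg⟩ ⟨h, hh⟩
    exact ⟨g * h, by rw [map_mul, hg, hh, aff_mul, aff_inj]; simp [add_comm]⟩
  neg_mem' := by
    rintro a ⟨g, hg⟩
    exact ⟨g⁻¹, by rw [map_inv, hg, aff_inv, aff_inj]; simp⟩

/-- The linear parts of the affine maps contained in a group of Möbius transformations. -/
def dil (π : Γ →* PGL(2, k)) : Subgroup kˣ where
  carrier := {t | ∃ g a, π g = aff t a}
  one_mem' := ⟨1, 0, by simp⟩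
  mul_mem' := by
    rintro s t ⟨g, a, hg⟩ ⟨h, b, hh⟩
    exact ⟨g * h, _, by rw [map_mul, hg, hh, aff_mul]⟩
  inv_mem' := by
    rintro t ⟨g, a, hg⟩
    exact ⟨g⁻¹, _, by rw [map_inv, hg, aff_inv]⟩

theorem mem_transl {π : Γ →* PGL(2, k)} {a : k} : a ∈ transl π ↔ ∃ g, π g = aff 1 a := Iff.rfl

theorem mem_dil {π : Γ →* PGL(2, k)} {t : kˣ} : t ∈ dil π ↔ ∃ g a, π g = aff t a := Iff.rfl

theorem dil_mul_mem_transl {π : Γ →* PGL(2, k)} {t : kˣ} (ht : t ∈ dil π) {a : k}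
    (ha : a ∈ transl π) : (t : k) * a ∈ transl π := by
  obtain ⟨g, b, hg⟩ := ht
  obtain ⟨h, hh⟩ := ha
  exact ⟨g * h * g⁻¹, by rw [map_mul, map_mul, map_inv, hg, hh, aff_conj_translation]⟩

variable [Finite Γ]

instance (π : Γ →* PGL(2, k)) : Finite (transl π) := by
  choose f hf using fun a : transl π => mem_transl.1 a.2
  refine Finite.of_injective f fun a b h => ?_
  have := (hf a).symm.trans ((congrArg π h).trans (hf b))
  exact Subtype.ext (aff_inj.1 this).2

instance (π : Γ →* PGL(2, k)) : Finite (dil π) := by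
  choose f e hf using fun a : dil π => mem_dil.1 a.2
  refine Finite.of_injective f fun a b h => ?_
  have := (hf a).symm.trans ((congrArg π h).trans (hf b))
  exact Subtype.ext (aff_inj.1 this).1

/-- The map t ↦ ta embeds the linear parts into the translations and misses 0. -/
theorem card_dil_lt (π : Γ →* PGL(2, k)) {a : k} (ha : a ∈ transl π) (ha0 : a ≠ 0) :
    Nat.card (dil π) < Nat.card (transl π) := by
  let f : Option (dil π) → transl π :=
    fun t => t.elim 0 fun t => ⟨(t : kˣ) * a, dil_mul_mem_transl t.2 ha⟩
  have hf : Function.Injective f := by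
    rintro (_ | s) (_ | t) h
    · rfl
    · have := congrArg Subtype.val h
      simp [f, ha0] at this
    · have := congrArg Subtype.val h
      simp [f, ha0] at this
    · have := congrArg Subtype.val h
      simp only [f, Option.elim] at this
      rw [mul_left_inj' ha0, Units.val_inj] at this
      rw [Subtype.ext this]
  have := Nat.card_le_card_of_injective f hf
  rw [Finite.card_option] at this
  omega

/-- If the linear parts are as numerous as possible, then they act transitively on the nonzero
translations. -/
theorem exists_dil_mul_eq (π : Γ →* PGL(2, k)) {a : k} (ha : a ∈ transl π) (ha0 : a ≠ 0)
    (hcard : Nat.card (transl π) ≤ Nat.card (dil π) + 1) {x : k} (hx : x ∈ transl π)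
    (hx0 : x ≠ 0) : ∃ t ∈ dil π, x = (t : k) * a := by
  by_contra! H
  let f : Option (Option (dil π)) → transl π := fun t => t.elim ⟨x, hx⟩ fun t =>
    t.elim 0 fun t => ⟨(t : kˣ) * a, dil_mul_mem_transl t.2 ha⟩
  have hf : Function.Injective f := by
    rintro (_ | _ | s) (_ | _ | t) h <;> try rfl
    · exact absurd (congrArg Subtype.val h) hx0
    · exact absurd (congrArg Subtype.val h) (H t t.2)
    · exact absurd (congrArg Subtype.val h).symm hx0
    · have := congrArg Subtype.val h
      simp [f, ha0] at this
    · exact absurd (congrArg Subtype.val h).symm (H s s.2)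
    · have := congrArg Subtype.val h
      simp [f, ha0] at this
    · have := congrArg Subtype.val h
      simp only [f, Option.elim] at this
      rw [mul_left_inj' ha0, Units.val_inj] at this
      rw [Subtype.ext this]
  have := Nat.card_le_card_of_injective f hf
  rw [Finite.card_option, Finite.card_option] at this
  omega

/-- The linear parts coming from ker μ form a proper subgroup: an element of ker μ with the linear
part of b would differ from b by a translation, on which μ is trivial. -/
theorem two_mul_card_dil_ker_le (π : Γ →* PGL(2, k)) (μ : Γ →* kˣ)
    (htr : ∀ g a, π g = aff 1 a → μ g = 1) {b : Γ} {t : kˣ} {a : k} (hb : π b = aff t a)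
    (hμb : μ b ≠ 1) : 2 * Nat.card (dil (π.comp μ.ker.subtype)) ≤ Nat.card (dil π) := by
  set D₀ := dil (π.comp μ.ker.subtype)
  have hle : D₀ ≤ dil π := by
    rintro t ⟨g, a, hg⟩
    exact ⟨g, a, hg⟩
  have hne : D₀ ≠ dil π := by
    intro h
    have : t ∈ D₀ := by rw [h]; exact ⟨b, a, hb⟩
    obtain ⟨g, a', hg⟩ := this
    have h1 : μ (b * (g : Γ)⁻¹) = 1 := htr _ (t * (-((t⁻¹ : kˣ) : k) * a') + a) (by
      have hg' : π (g : Γ) = aff t a' := hg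
      rw [map_mul, map_inv, hb, hg', aff_inv, aff_mul, mul_inv_cancel])
    rw [map_mul, map_inv, MonoidHom.mem_ker.1 g.2] at h1
    exact hμb (by simpa using h1)
  obtain ⟨m, hm⟩ := Subgroup.card_dvd_of_le hle
  have hlt : Nat.card D₀ < Nat.card (dil π) := by
    by_contra! H
    exact hne (Subgroup.eq_of_le_of_card_ge hle H)
  rw [hm] at hlt ⊢
  have : 2 ≤ m := by
    rcases m with _ | _ | m
    · omega
    · omega
    · omega
  nlinarith

variable [DecidableEq k]

/-- In the presence of `x ↦ -x`, the finite fixed points of nontrivial affine elements are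
translates of `0`. -/
theorem mem_transl_of_fix (h2 : (2 : k) ≠ 0) (π : Γ →* PGL(2, k)) {s : Γ}
    (hs : π s = aff (-1) 0) {b : Γ} (hb1 : π b ≠ 1) (hb : π b • (∞ : OnePoint k) = ∞) {y : k}
    (hy : π b • (y : OnePoint k) = y) : y ∈ transl π := by
  obtain ⟨t, a, hta⟩ := exists_eq_aff hb
  rw [hta, aff_smul_coe, OnePoint.coe_eq_coe] at hy
  have ht : (t : k) ≠ 1 := by
    intro h
    apply hb1
    rw [hta, ← aff_one_zero, aff_inj]
    refine ⟨Units.ext h, ?_⟩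
    rw [h] at hy
    linear_combination hy
  have hD : t ∈ dil π := ⟨b, a, hta⟩
  -- The commutator of b and s is the translation by 2a.
  have h2a : 2 * a ∈ transl π := by
    refine ⟨b * s * b⁻¹ * s⁻¹, ?_⟩
    rw [map_mul, map_mul, map_mul, map_inv, map_inv, hta, hs, aff_inv, aff_inv, aff_mul, aff_mul,
      aff_mul, aff_inj]
    simp [two_mul]
  -- The fixed point is y = a/(1 - t). Multiplication by 2(1 - t) is injective on the finite set A,
  -- hence surjective, so it reaches 2a.
  let f : transl π → transl π := fun x => ⟨2 * (1 - t) * x, by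
    have := sub_mem x.2 (dil_mul_mem_transl hD x.2)
    convert add_mem this this using 1
    ring⟩
  have hne : 2 * (1 - (t : k)) ≠ 0 := mul_ne_zero h2 (sub_ne_zero.2 ht.symm)
  have hf : Function.Injective f := by
    intro x y h
    have := congrArg Subtype.val h
    simp only [f] at this
    exact Subtype.ext (mul_left_cancel₀ hne this)
  obtain ⟨x, hx⟩ := Finite.surjective_of_injective hf ⟨2 * a, h2a⟩
  have hx' : 2 * (1 - (t : k)) * x = 2 * a := congrArg Subtype.val hx
  have : y = x := by
    apply mul_left_cancel₀ hne
    rw [hx']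
    linear_combination (-2) * hy
  rw [this]; exact x.2

end Counting

/-! ### The orbit of ∞, by double counting. -/

/-- In the application q = |A|, e = |D|, d counts linear parts from ker μ, r counts orbit points
outside A ∪ {∞}, and Q, M count conjugates of s fixing and moving ∞. The hypotheses give (q + r -
1)q ≤ 2M ≤ qe + 2r ≤ q(q - 1) + 2r, so rq ≤ 2r; thus r = 0, and then q - 1 ≤ e. -/
theorem orbit_arithmetic {q r d e Q M : ℕ} (h : (q + r + 1) * Q ≤ (Q + M) * 2)
    (hM : M ≤ q * d + r) (hd : 2 * d ≤ e) (he : e < q) (hQ : q ≤ Q) (hq : 3 ≤ q) :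
    r = 0 ∧ q ≤ e + 1 := by
  obtain ⟨p, rfl⟩ : ∃ p, q = p + 1 := ⟨q - 1, by omega⟩
  have h1 : (p + r) * (p + 1) ≤ (p + r) * Q := Nat.mul_le_mul_left _ hQ
  have h2 : (p + r) * Q ≤ 2 * M := by linarith
  have h3 : (p + 1) * (2 * d) ≤ (p + 1) * e := Nat.mul_le_mul_left _ hd
  have h4 : (p + 1) * e ≤ (p + 1) * p := Nat.mul_le_mul_left _ (by omega)
  have h5 : (p + r) * (p + 1) ≤ (p + 1) * e + 2 * r := by linarith
  have h6 : r * (p + 1) ≤ 2 * r := by linarith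
  have hr : r = 0 := by
    by_contra hr
    have : r * 3 ≤ r * (p + 1) := Nat.mul_le_mul_left _ hq
    omega
  subst hr
  refine ⟨rfl, ?_⟩
  have h7 : (p + 1) * p ≤ (p + 1) * e := by linarith
  have := Nat.le_of_mul_le_mul_left h7 (by omega)
  omega

section Orbit

variable {k : Type*} [Field k] [DecidableEq k] {Γ : Type*} [Group Γ]

/-- Conjugates of an involution that send `x` to `y` send `y` back to `x`. -/
theorem isConj_smul_symm (π : Γ →* PGL(2, k)) {s σ : Γ} (hs : π s = aff (-1) 0)
    (hσ : IsConj s σ) {x y : OnePoint k} (h : π σ • x = y) : π σ • y = x := by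
  obtain ⟨g, rfl⟩ := isConj_iff.1 hσ
  rw [← h, ← mul_smul, ← map_mul]
  have h1 : π s * π s = 1 := by rw [hs, aff_mul, ← aff_one_zero, aff_inj]; simp
  have h2 : π (g * s * g⁻¹ * (g * s * g⁻¹)) = 1 := by
    have : g * s * g⁻¹ * (g * s * g⁻¹) = g * (s * s) * g⁻¹ := by group
    rw [this, map_mul, map_mul, map_mul, h1, mul_one, map_inv, mul_inv_cancel]
  rw [h2, one_smul]

open Classical in
-- Two such conjugates both swap ∞ and y, so their quotient is a nontrivial affine map fixing y;
-- `mem_transl_of_fix` then makes y a translation.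
theorem card_conj_moving_le_one [Fintype Γ] (h2 : (2 : k) ≠ 0) (π : Γ →* PGL(2, k))
    (hπ : Function.Injective π) {s : Γ} (hs : π s = aff (-1) 0) {y : OnePoint k}
    (hy : y ≠ ∞) (hyA : ∀ a ∈ transl π, y ≠ (a : OnePoint k)) :
    (Finset.univ.filter fun σ : Γ => IsConj s σ ∧ π σ • (∞ : OnePoint k) = y).card ≤ 1 := by
  rw [Finset.card_le_one]
  intro σ hσ τ hτ
  simp only [Finset.mem_filter, Finset.mem_univ, true_and] at hσ hτ
  by_contra hne
  have h1 : π (σ⁻¹ * τ) • (∞ : OnePoint k) = ∞ := by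
    rw [map_mul, mul_smul, hτ.2, ← hσ.2, map_inv, inv_smul_smul]
  have h3 : π (σ⁻¹ * τ) • y = y := by
    rw [map_mul, mul_smul, isConj_smul_symm π hs hτ.1 hτ.2, map_inv, inv_smul_eq_iff,
      isConj_smul_symm π hs hσ.1 hσ.2]
  have h4 : π (σ⁻¹ * τ) ≠ 1 := by
    rw [← map_one π]
    intro h
    exact hne (inv_mul_eq_one.1 (hπ h))
  cases y with
  | infty => exact hy rfl
  | coe y => exact hyA y (mem_transl_of_fix h2 π hs h4 h1 h3) rfl

open Classical in
-- The quotient of two such conjugates is an affine map fixing y, hence determined by its linear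
-- part, and it lies in ker μ because conjugates have equal μ.
theorem card_conj_moving_le [Fintype Γ] (π : Γ →* PGL(2, k))
    (hπ : Function.Injective π) (μ : Γ →* kˣ) {s : Γ} (hs : π s = aff (-1) 0) (y : k) :
    (Finset.univ.filter fun σ : Γ => IsConj s σ ∧ π σ • (∞ : OnePoint k) = y).card ≤
      Nat.card (dil (π.comp μ.ker.subtype)) := by
  set F := Finset.univ.filter fun σ : Γ => IsConj s σ ∧ π σ • (∞ : OnePoint k) = y with hF
  rcases F.eq_empty_or_nonempty with h | ⟨σ, hσ⟩
  · rw [h]; simp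
  have hF' : ∀ τ : F, IsConj s (τ : Γ) ∧ π τ • (∞ : OnePoint k) = y := fun τ => by
    simpa [hF] using τ.2
  have hσ := hF' ⟨σ, hσ⟩
  have hμ : ∀ τ : F, μ τ = μ s := by
    intro τ
    obtain ⟨g, hg⟩ := isConj_iff.1 (hF' τ).1
    rw [← hg]; simp
  have h1 : ∀ τ : F, π (σ⁻¹ * τ) • (∞ : OnePoint k) = ∞ := fun τ => by
    rw [map_mul, mul_smul, (hF' τ).2, ← hσ.2, map_inv, inv_smul_smul]
  have h3 : ∀ τ : F, π (σ⁻¹ * τ) • (y : OnePoint k) = y := fun τ => by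
    rw [map_mul, mul_smul, isConj_smul_symm π hs (hF' τ).1 (hF' τ).2, map_inv, inv_smul_eq_iff,
      isConj_smul_symm π hs hσ.1 hσ.2]
  choose t a hta using fun τ : F => exists_eq_aff (h1 τ)
  let f : F → dil (π.comp μ.ker.subtype) := fun τ => ⟨t τ, ⟨σ⁻¹ * τ, by
    rw [MonoidHom.mem_ker, map_mul, map_inv, hμ τ, hμ ⟨σ, by assumption⟩, inv_mul_cancel]⟩, a τ,
    hta τ⟩
  have hf : Function.Injective f := by
    intro τ τ' h
    have ht : t τ = t τ' := congrArg Subtype.val h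
    have e1 := h3 τ
    have e2 := h3 τ'
    rw [hta, aff_smul_coe, OnePoint.coe_eq_coe] at e1 e2
    have ha : a τ = a τ' := by
      rw [ht] at e1
      linear_combination e1 - e2
    have := (hta τ).trans ((congrArg₂ aff ht ha).trans (hta τ').symm)
    exact Subtype.ext (mul_left_cancel (hπ this))
  have := Nat.card_le_card_of_injective f hf
  rwa [Nat.card_eq_fintype_card, Fintype.card_coe] at this

open Classical in
/-- The number of conjugates of `s` fixing `∞` is at least the number of translations. -/
theorem card_transl_le_card_conj [Fintype Γ] (h2 : (2 : k) ≠ 0) (π : Γ →* PGL(2, k)) {s : Γ}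
    (hs : π s = aff (-1) 0) : Nat.card (transl π) ≤
      (Finset.univ.filter fun σ : Γ => IsConj s σ ∧ π σ • (∞ : OnePoint k) = ∞).card := by
  choose u hu using fun a : transl π => mem_transl.1 a.2
  have hval : ∀ a, π (u a * s * (u a)⁻¹) = aff (-1) (2 * (a : k)) := fun a => by
    rw [map_mul, map_mul, map_inv, hs, hu, aff_inv, aff_mul, aff_mul, aff_inj]
    simp [two_mul]
  let f : transl π →
      (Finset.univ.filter fun σ : Γ => IsConj s σ ∧ π σ • (∞ : OnePoint k) = ∞) :=
    fun a => ⟨u a * s * (u a)⁻¹, by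
      simp only [Finset.mem_filter, Finset.mem_univ, true_and]
      exact ⟨isConj_iff.2 ⟨u a, rfl⟩, by rw [hval, aff_smul_infty]⟩⟩
  have hf : Function.Injective f := by
    intro a b h
    have h' := congrArg π (congrArg Subtype.val h)
    simp only [f] at h'
    rw [hval, hval, aff_inj] at h'
    exact Subtype.ext (mul_left_cancel₀ h2 h'.2)
  have := Nat.card_le_card_of_injective f hf
  exact this.trans_eq (by rw [Nat.card_eq_fintype_card, Fintype.card_coe])

open Classical in
/-- Double counting of pairs consisting of a conjugate of `s` and a fixed point of it in a
transitive `Γ`-set. -/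
theorem card_orbit_mul_le [Fintype Γ] (π : Γ →* PGL(2, k)) {s : Γ} (Ω F : Finset (OnePoint k))
    (hΩ : ∀ y, y ∈ Ω ↔ ∃ g, π g • (∞ : OnePoint k) = y)
    (hF : ∀ y ∈ Ω, π s • y = y → y ∈ F) :
    Ω.card * (Finset.univ.filter fun σ : Γ => IsConj s σ ∧ π σ • (∞ : OnePoint k) = ∞).card ≤
      (Finset.univ.filter fun σ : Γ => IsConj s σ).card * F.card := by
  set S := Finset.univ.filter fun σ : Γ => IsConj s σ
  have hdc := Finset.sum_card_bipartiteAbove_eq_sum_card_bipartiteBelow (s := S) (t := Ω)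
    (fun σ y => π σ • y = y)
  have hΩg : ∀ g, ∀ y ∈ Ω, π g • y ∈ Ω := by
    intro g y hy
    obtain ⟨h, rfl⟩ := (hΩ y).1 hy
    exact (hΩ _).2 ⟨g * h, by rw [map_mul, mul_smul]⟩
  have hle1 : ∑ σ ∈ S, (Finset.bipartiteAbove (fun σ y => π σ • y = y) Ω σ).card ≤
      S.card * F.card := by
    rw [← smul_eq_mul]
    refine Finset.sum_le_card_nsmul _ _ _ fun σ hσ => ?_
    obtain ⟨g, rfl⟩ := isConj_iff.1 (Finset.mem_filter.1 hσ).2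
    refine Finset.card_le_card_of_injOn (fun y => π g⁻¹ • y) ?_ ?_
    · intro y hy
      simp only [Finset.mem_coe, Finset.bipartiteAbove, Finset.mem_filter] at hy
      refine hF _ (hΩg _ _ hy.1) ?_
      have := hy.2
      rw [map_mul, map_mul, mul_smul, mul_smul, map_inv] at this
      rw [map_inv, eq_inv_smul_iff, this]
    · intro x _ y _ h
      exact smul_left_cancel _ h
  have hle2 : Ω.card *
      (Finset.univ.filter fun σ : Γ => IsConj s σ ∧ π σ • (∞ : OnePoint k) = ∞).card ≤
      ∑ y ∈ Ω, (Finset.bipartiteBelow (fun σ y => π σ • y = y) S y).card := by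
    rw [← smul_eq_mul]
    refine Finset.card_nsmul_le_sum _ _ _ fun y hy => ?_
    obtain ⟨g, rfl⟩ := (hΩ y).1 hy
    refine Finset.card_le_card_of_injOn (fun σ => g * σ * g⁻¹) ?_ ?_
    · intro σ hσ
      simp only [Finset.mem_coe, Finset.mem_filter, Finset.mem_univ, true_and] at hσ
      simp only [Finset.mem_coe, Finset.bipartiteBelow, Finset.mem_filter, S, Finset.mem_univ,
        true_and]
      refine ⟨hσ.1.trans (isConj_iff.2 ⟨g, rfl⟩), ?_⟩
      rw [map_mul, map_mul, map_inv, mul_smul, mul_smul, inv_smul_smul, hσ.2]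
    · intro x _ y _ h
      simpa using h
  exact (hle2.trans hdc.ge).trans hle1

/-- The orbit of `∞` consists of `∞` and the translates of `0`, and the linear parts of the affine
elements act simply transitively on the nonzero translations. -/
theorem orbit_eq [Finite Γ] (h2 : (2 : k) ≠ 0) (π : Γ →* PGL(2, k)) (hπ : Function.Injective π)
    (μ : Γ →* kˣ) {s : Γ} (hs : π s = aff (-1) 0) {a₀ : k} (ha₀ : a₀ ∈ transl π) (ha₀' : a₀ ≠ 0)
    (htr : ∀ g a, π g = aff 1 a → μ g = 1) {b : Γ} {t : kˣ} {a : k} (hb : π b = aff t a)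
    (hμb : μ b ≠ 1) (hmove : ∃ g, π g • (∞ : OnePoint k) ≠ ∞) :
    (∀ y : k, (∃ g, π g • (∞ : OnePoint k) = y) ↔ y ∈ transl π) ∧
      Nat.card (transl π) ≤ Nat.card (dil π) + 1 := by
  classical
  have := Fintype.ofFinite Γ
  set Ω : Finset (OnePoint k) := Finset.univ.image fun g : Γ => π g • (∞ : OnePoint k) with hΩdef
  have hΩ : ∀ y, y ∈ Ω ↔ ∃ g, π g • (∞ : OnePoint k) = y := fun y => by simp [hΩdef]
  have hinf : (∞ : OnePoint k) ∈ Ω := (hΩ _).2 ⟨1, by simp⟩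
  have hcard : (Ω.erase ∞).card + 1 = Ω.card := Finset.card_erase_add_one hinf
  set d := Nat.card (dil (π.comp μ.ker.subtype))
  have hd : 2 * d ≤ Nat.card (dil π) := two_mul_card_dil_ker_le π μ htr hb hμb
  have hdq : Nat.card (dil π) < Nat.card (transl π) := card_dil_lt π ha₀ ha₀'
  have hd1 : 1 ≤ d := Nat.card_pos
  set q := Nat.card (transl π)
  -- 2 ≤ 2d ≤ |D| < q.
  have hq : 3 ≤ q := by omega
  set Q' := (Finset.univ.filter fun σ : Γ => IsConj s σ ∧ π σ • (∞ : OnePoint k) = ∞).card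
  have hQ' : q ≤ Q' := card_transl_le_card_conj h2 π hs
  set S := Finset.univ.filter fun σ : Γ => IsConj s σ with hS
  set M := Finset.univ.filter fun σ : Γ => IsConj s σ ∧ π σ • (∞ : OnePoint k) ≠ ∞ with hM
  have hSM : S.card = Q' + M.card := by
    have := Finset.card_filter_add_card_filter_not (s := S) (fun σ => π σ • (∞ : OnePoint k) = ∞)
    rw [Finset.filter_filter, Finset.filter_filter] at this
    exact this.symm
  have hMsum : M.card = ∑ y ∈ Ω.erase ∞,
      (Finset.univ.filter fun σ : Γ => IsConj s σ ∧ π σ • (∞ : OnePoint k) = y).card := by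
    rw [Finset.card_eq_sum_card_fiberwise (f := fun σ : Γ => π σ • (∞ : OnePoint k))
      (t := Ω.erase ∞)]
    · refine Finset.sum_congr rfl fun y hy => ?_
      congr 1
      ext σ
      simp only [hM, Finset.mem_filter, Finset.mem_univ, true_and]
      have := (Finset.mem_erase.1 hy).1
      constructor
      · rintro ⟨⟨h1, -⟩, h3⟩; exact ⟨h1, h3⟩
      · rintro ⟨h1, h3⟩; exact ⟨⟨h1, by rwa [h3]⟩, h3⟩
    · intro σ hσ
      simp only [hM, Finset.coe_filter, Finset.mem_univ, true_and, Set.mem_ofPred_eq] at hσ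
      exact Finset.mem_coe.2 (Finset.mem_erase.2 ⟨hσ.2, (hΩ _).2 ⟨σ, rfl⟩⟩)
  have hfin : (transl π : Set k).Finite :=
    Set.finite_coe_iff.1 (inferInstanceAs (Finite (transl π)))
  set A : Finset (OnePoint k) := hfin.toFinset.image ((↑) : k → OnePoint k) with hA
  have hAmem : ∀ y, y ∈ A ↔ ∃ a ∈ transl π, (a : OnePoint k) = y := fun y => by simp [hA]
  have hAcard : A.card = q := by
    rw [hA, Finset.card_image_of_injective _ OnePoint.coe_injective,
      ← Set.ncard_eq_toFinset_card _ hfin]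
    rfl
  set ΩA := (Ω.erase ∞).filter (· ∈ A)
  set r := ((Ω.erase ∞).filter (· ∉ A)).card
  have hΩA : ΩA.card + r = (Ω.erase ∞).card := Finset.card_filter_add_card_filter_not _
  have hMle : M.card ≤ ΩA.card * d + r := by
    rw [hMsum, ← Finset.sum_filter_add_sum_filter_not _ (· ∈ A)]
    refine add_le_add ?_ ?_
    · rw [← smul_eq_mul]
      refine Finset.sum_le_card_nsmul _ _ _ fun y hy => ?_
      obtain ⟨a, -, rfl⟩ := (hAmem y).1 (Finset.mem_filter.1 hy).2
      exact card_conj_moving_le π hπ μ hs a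
    · rw [← mul_one r, ← smul_eq_mul]
      refine Finset.sum_le_card_nsmul _ _ _ fun y hy => ?_
      have hy := Finset.mem_filter.1 hy
      refine card_conj_moving_le_one h2 π hπ hs (Finset.mem_erase.1 hy.1).1 ?_
      rintro a ha rfl
      exact hy.2 ((hAmem _).2 ⟨a, ha, rfl⟩)
  have hsfix : ∀ y, π s • y = y → y = ∞ ∨ y = ((0 : k) : OnePoint k) := by
    intro y hy
    cases y with
    | infty => exact Or.inl rfl
    | coe y =>
      right
      rw [hs, aff_smul_coe, OnePoint.coe_eq_coe] at hy
      rw [OnePoint.coe_eq_coe]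
      have : 2 * y = 0 := by
        simp at hy
        linear_combination -hy
      simpa [h2] using this
  have hn : 1 ≤ (Ω.erase ∞).card := by
    obtain ⟨g, hg⟩ := hmove
    exact Finset.card_pos.2 ⟨_, Finset.mem_erase.2 ⟨hg, (hΩ _).2 ⟨g, rfl⟩⟩⟩
  have htransΩ : ∀ a ∈ transl π, ((0 : k) : OnePoint k) ∈ Ω → (a : OnePoint k) ∈ Ω := by
    rintro a ⟨u, hu⟩ h0
    obtain ⟨g, hg⟩ := (hΩ _).1 h0
    exact (hΩ _).2 ⟨u * g, by rw [map_mul, mul_smul, hg, hu, aff_smul_coe]; simp⟩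
  -- Otherwise s fixes only ∞ in the orbit, and no orbit point lies in A. With n = |Ω| - 1 ≥ 1 the
  -- count gives (n + 1)Q' ≤ Q' + n, against Q' ≥ 3.
  have h0 : ((0 : k) : OnePoint k) ∈ Ω := by
    by_contra h0
    have hAempty : ΩA.card = 0 := by
      rw [Finset.card_eq_zero, Finset.filter_eq_empty_iff]
      intro y hy hyA
      obtain ⟨a, ⟨u, hu⟩, rfl⟩ := (hAmem y).1 hyA
      obtain ⟨g, hg⟩ := (hΩ _).1 (Finset.mem_erase.1 hy).2
      refine h0 ((hΩ _).2 ⟨u⁻¹ * g, ?_⟩)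
      rw [map_mul, mul_smul, hg, map_inv, inv_smul_eq_iff, hu, aff_smul_coe]
      simp
    have hdc := card_orbit_mul_le π (s := s) Ω {∞} hΩ (by
      intro y hy hys
      rcases hsfix y hys with h | h
      · simp [h]
      · rw [h] at hy; exact absurd hy h0)
    rw [Finset.card_singleton, mul_one] at hdc
    have hdc : Ω.card * Q' ≤ S.card := hdc
    rw [hSM, ← hcard] at hdc
    have h1 : (Ω.erase ∞).card * Q' ≤ (Ω.erase ∞).card := by
      rw [hAempty] at hMle hΩA
      nlinarith
    have h3 : (Ω.erase ∞).card * 3 ≤ (Ω.erase ∞).card * Q' :=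
      Nat.mul_le_mul_left _ (by omega)
    omega
  have hAΩ : ΩA = A := by
    ext y
    simp only [ΩA, Finset.mem_filter, Finset.mem_erase]
    refine ⟨fun h => h.2, fun h => ⟨?_, h⟩⟩
    obtain ⟨a, ha, rfl⟩ := (hAmem y).1 h
    exact ⟨OnePoint.coe_ne_infty a, htransΩ a ha h0⟩
  have hdc := card_orbit_mul_le π (s := s) Ω {∞, ((0 : k) : OnePoint k)} hΩ (by
    intro y hy hys
    simpa using hsfix y hys)
  have hdc : Ω.card * Q' ≤ S.card * 2 := hdc.trans (Nat.mul_le_mul_left _ Finset.card_le_two)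
  rw [hAΩ, hAcard] at hMle hΩA
  rw [hSM, ← hcard, ← hΩA] at hdc
  obtain ⟨hr, hqe⟩ := orbit_arithmetic hdc hMle hd hdq hQ' hq
  refine ⟨fun y => ?_, ?_⟩
  · rw [← hΩ]
    refine ⟨fun hy => ?_, fun hy => htransΩ y hy h0⟩
    by_contra hyA
    have : (y : OnePoint k) ∈ (Ω.erase ∞).filter (· ∉ A) := by
      refine Finset.mem_filter.2 ⟨Finset.mem_erase.2 ⟨OnePoint.coe_ne_infty y, hy⟩, ?_⟩
      rw [hAmem]
      rintro ⟨a, ha, h⟩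
      rw [OnePoint.coe_eq_coe] at h
      exact hyA (h ▸ ha)
    have := Finset.card_pos.2 ⟨_, this⟩
    omega
  · exact hqe

end Orbit

/-! ### Cocycles on the translation group. -/

/-- The restriction of a normalized cocycle to the group of translations, in coordinates. -/
theorem translation_cocycle {k : Type*} [Field k] (h2 : (2 : k) ≠ 0) (A : AddSubgroup k)
    (D : Subgroup kˣ) (h1 : (1 : k) ∈ A) (hAD : ∀ x ∈ A, x ≠ 0 → ∃ t ∈ D, (t : k) = x)
    (hDA : ∀ t ∈ D, (t : k) ∈ A) (m : kˣ → k) (hm : ∀ t ∈ D, m t ^ 2 = 1)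
    (hm' : ∃ t ∈ D, m t = -1) (p q r : k → k)
    (hp : ∀ a ∈ A, ∀ b ∈ A, p (a + b) = p a + p b + a * r b)
    (hq : ∀ a ∈ A, ∀ b ∈ A, q (a + b) = q a + q b - 2 * a * p b - a ^ 2 * r b)
    (hrt : ∀ t ∈ D, ∀ a ∈ A, (t : k) * r (t * a) = m t * r a)
    (hpt : ∀ t ∈ D, ∀ a ∈ A, p (t * a) = m t * p a)
    (hqt : ∀ t ∈ D, ∀ a ∈ A, q (t * a) = m t * t * q a) :
    (∃ e, ∀ a ∈ A, p a = a * e ∧ q a = -(a ^ 2 * e) ∧ r a = 0) ∨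
      ((5 : k) = 0 ∧ ∀ t ∈ D, t ^ 4 = 1) := by
  obtain ⟨t₀, ht₀, hmt₀⟩ := hm'
  -- Translations commute: compare p(1 + b) with p(b + 1).
  have hr1 : ∀ b ∈ A, r b = b * r 1 := fun b hb => by
    have e1 := hp 1 h1 b hb
    have e2 := hp b hb 1 h1
    rw [add_comm b 1, e1] at e2
    linear_combination e2
  by_cases hr0 : r 1 = 0
  · left
    have hrz : ∀ a ∈ A, r a = 0 := fun a ha => by rw [hr1 a ha, hr0, mul_zero]
    have hp1 : ∀ b ∈ A, p b = b * p 1 := fun b hb => by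
      have e1 := hq 1 h1 b hb
      have e2 := hq b hb 1 h1
      rw [add_comm b 1, e1, hrz b hb, hrz 1 h1] at e2
      apply mul_left_cancel₀ h2
      linear_combination -e2
    have hpm : ∀ t ∈ D, (t : k) * p 1 = m t * p 1 := fun t ht => by
      have := hpt t ht 1 h1
      rwa [mul_one, hp1 _ (hDA t ht)] at this
    -- The defect of q from the coboundary shape; it is additive and equivariant, which will force
    -- it to vanish.
    set s : k → k := fun a => q a + a ^ 2 * p 1 with hs
    have hsadd : ∀ a ∈ A, ∀ b ∈ A, s (a + b) = s a + s b := fun a ha b hb => by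
      simp only [hs]
      rw [hq a ha b hb, hrz b hb, hp1 b hb]
      ring
    have hst : ∀ t ∈ D, ∀ a ∈ A, s (t * a) = m t * t * s a := fun t ht a ha => by
      simp only [hs]
      rw [hqt t ht a ha]
      linear_combination a ^ 2 * (t : k) * hpm t ht
    have hs0 : s 0 = 0 := by
      have := hsadd 0 A.zero_mem 0 A.zero_mem
      rw [add_zero] at this
      linear_combination -this
    have hst1 : ∀ t ∈ D, s t = m t * t * s 1 := fun t ht => by
      have := hst t ht 1 h1
      rwa [mul_one] at this
    -- Expand s(1 + t₀) with m(t₀) = -1. Either 1 + t₀ = 0, or 1 + t₀ ∈ D with sign ±1; each case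
    -- gives 2s(1) = 0 or 2t₀s(1) = 0.
    have hs1 : s 1 = 0 := by
      have e1 := hsadd 1 h1 t₀ (hDA _ ht₀)
      rw [hst1 t₀ ht₀, hmt₀] at e1
      apply mul_left_cancel₀ h2
      by_cases h : 1 + (t₀ : k) = 0
      · rw [h, hs0] at e1
        linear_combination -e1 + s 1 * h
      · obtain ⟨t, ht, htt⟩ := hAD _ (A.add_mem h1 (hDA _ ht₀)) h
        rw [← htt, hst1 t ht] at e1
        rcases mul_self_eq_one_iff.1 ((sq _).symm.trans (hm t ht)) with h' | h'
        · rw [h', htt] at e1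
          apply mul_left_cancel₀ t₀.ne_zero
          linear_combination e1
        · rw [h', htt] at e1
          linear_combination -e1
    refine ⟨p 1, fun a ha => ⟨hp1 a ha, ?_, hrz a ha⟩⟩
    have : s a = 0 := by
      by_cases h : a = 0
      · rw [h, hs0]
      · obtain ⟨t, ht, rfl⟩ := hAD a ha h
        rw [hst1 t ht, hs1, mul_zero]
    linear_combination this
  -- Here m(t) = t², so t⁴ = 1 on D and t₀² = -1. Since 1 + t₀ is nonzero it lies in D, whence 1 =
  -- (1 + t₀)⁴ = (2t₀)² = -4.
  · right
    have hmt : ∀ t ∈ D, m t = (t : k) ^ 2 := fun t ht => by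
      have := hrt t ht 1 h1
      rw [mul_one, hr1 _ (hDA t ht)] at this
      apply mul_right_cancel₀ hr0
      linear_combination -this
    have h4 : ∀ t ∈ D, (t : k) ^ 4 = 1 := fun t ht => by
      have := hm t ht
      rw [hmt t ht] at this
      linear_combination this
    refine ⟨?_, fun t ht => by ext; simpa using h4 t ht⟩
    have ht2 : (t₀ : k) ^ 2 = -1 := by rw [← hmt t₀ ht₀, hmt₀]
    have hne : 1 + (t₀ : k) ≠ 0 := fun h => h2 (by linear_combination (1 - (t₀ : k)) * h + ht2)
    obtain ⟨t, ht, htt⟩ := hAD _ (A.add_mem h1 (hDA _ ht₀)) hne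
    have := h4 t ht
    rw [htt] at this
    linear_combination -this + ((t₀ : k) ^ 2 + 4 * t₀ + 5) * ht2

/-! ### Structure of sharp groups. -/

section Normalized

variable {k : Type*} [Field k] [DecidableEq k] {Γ : Type*} [Group Γ]

/-- A faithful group of Möbius transformations with translation group `A` and group of linear parts
`D` is sharp if `1 ∈ A`, `A ⊆ D ∪ {0}` and the orbit of `∞` is `A ∪ {∞}`. -/
structure IsSharp (π : Γ →* PGL(2, k)) : Prop where
  inj : Function.Injective π
  one_mem : (1 : k) ∈ transl π
  orbit : ∀ y : k, (∃ g, π g • (∞ : OnePoint k) = y) ↔ y ∈ transl π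
  exists_dil : ∀ x ∈ transl π, x ≠ 0 → ∃ t ∈ dil π, (t : k) = x

namespace IsSharp

variable {π : Γ →* PGL(2, k)} (h : IsSharp π)
include h

theorem dil_mem {t : kˣ} (ht : t ∈ dil π) : (t : k) ∈ transl π := by
  simpa using dil_mul_mem_transl ht h.one_mem

theorem smul_mem {g : Γ} {x y : k} (hx : x ∈ transl π)
    (hg : π g • (x : OnePoint k) = y) : y ∈ transl π := by
  obtain ⟨w, hw⟩ := (h.orbit x).2 hx
  exact (h.orbit y).1 ⟨g * w, by rw [map_mul, mul_smul, hw, hg]⟩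

theorem mem_of_aff {g : Γ} {t : kˣ} {a : k} (hg : π g = aff t a) : a ∈ transl π :=
  h.smul_mem (zero_mem _) (g := g) (by rw [hg, aff_smul_coe]; simp)

theorem exists_aff {t : kˣ} (ht : t ∈ dil π) {a : k} (ha : a ∈ transl π) :
    ∃ g, π g = aff t a := by
  obtain ⟨g, b, hg⟩ := ht
  obtain ⟨u, hu⟩ := sub_mem ha (h.mem_of_aff hg)
  exact ⟨u * g, by rw [map_mul, hu, hg, aff_mul, aff_inj]; simp⟩

/-- If g sends ∞ to 0, then y = g⁻¹∞ is a finite orbit point, hence a translation; g after x ↦ x + y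
swaps 0 and ∞. -/
theorem exists_inversion : ∃ w c, π w = inversion c := by
  obtain ⟨g, hg⟩ := (h.orbit 0).2 (zero_mem _)
  have hne : π g⁻¹ • (∞ : OnePoint k) ≠ ∞ := by
    intro H
    rw [map_inv, inv_smul_eq_iff, hg] at H
    exact OnePoint.coe_ne_infty _ H.symm
  obtain ⟨y, hy⟩ := OnePoint.ne_infty_iff_exists.1 hne
  obtain ⟨u, hu⟩ := (h.orbit y).1 ⟨g⁻¹, hy.symm⟩
  obtain ⟨c, hc⟩ := exists_eq_inversion (p := π (g * u))
    (by rw [map_mul, mul_smul, hu, aff_smul_infty, hg])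
    (by
      rw [map_mul, mul_smul, hu, aff_smul_coe]
      simp only [Units.val_one, mul_zero, zero_add]
      rw [hy, map_inv, smul_inv_smul])
  exact ⟨_, c, hc⟩

/-- Conjugation by x ↦ c/x inverts x ↦ tx, so μ(g) = μ(g)⁻¹. -/
theorem sq_char_eq_one {R : Type*} [CommGroup R] (μ : Γ →* R) {g : Γ} {t : kˣ}
    (hg : π g = aff t 0) : μ g ^ 2 = 1 := by
  obtain ⟨w, c, hw⟩ := h.exists_inversion
  have : w * g = g⁻¹ * w := h.inj (by
    rw [map_mul, map_mul, map_inv, hw, hg, inversion_mul_aff, aff_inv, mul_zero])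
  have := congrArg μ this
  rw [map_mul, map_mul, mul_comm, mul_left_inj, map_inv] at this
  rw [sq, mul_eq_one_iff_eq_inv, ← this]

theorem exists_linear_of_fix {R : Type*} [CommGroup R] (μ : Γ →* R)
    (htr : ∀ g a, π g = aff 1 a → μ g = 1) {g : Γ}
    (hg : π g • (∞ : OnePoint k) = ∞) : ∃ g' t, π g' = aff t 0 ∧ μ g = μ g' ∧ t ∈ dil π := by
  obtain ⟨t, a, hta⟩ := exists_eq_aff hg
  obtain ⟨u, hu⟩ := h.mem_of_aff hta
  refine ⟨u⁻¹ * g, t, ?_, ?_, ⟨g, a, hta⟩⟩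
  · rw [map_mul, map_inv, hu, hta, aff_inv, aff_mul, aff_inj]; simp
  · rw [map_mul, map_inv, htr u a hu]; simp

end IsSharp

end Normalized

/-! ### From translation functions to coboundaries. -/

section Coboundary

variable {k : Type*} [Field k] {Γ : Type*} [Group Γ]

/-- The elements acting as `x ↦ t x`. -/
def linearSubgroup (π : Γ →* PGL(2, k)) : Subgroup Γ where
  carrier := {g | ∃ t, π g = aff t 0}
  one_mem' := ⟨1, by simp⟩
  mul_mem' := by
    rintro g h ⟨t, hg⟩ ⟨t', hh⟩
    exact ⟨t * t', by rw [map_mul, hg, hh, aff_mul, aff_inj]; simp⟩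
  inv_mem' := by
    rintro g ⟨t, hg⟩
    exact ⟨t⁻¹, by rw [map_inv, hg, aff_inv, aff_inj]; simp⟩

theorem card_linearSubgroup_ne_zero (ℓ : ℕ) [Fact ℓ.Prime] [CharP k ℓ] [Finite Γ] {π : Γ →* PGL(2, k)}
    (hπ : Function.Injective π) : (Nat.card (linearSubgroup π) : k) ≠ 0 := by
  intro h
  rw [CharP.cast_eq_zero_iff k ℓ] at h
  obtain ⟨⟨g, t, hg⟩, ho⟩ := exists_prime_orderOf_dvd_card' ℓ h
  have h1 : g ^ ℓ = 1 := by
    have := pow_orderOf_eq_one (⟨g, t, hg⟩ : linearSubgroup π)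
    rw [ho] at this
    exact congrArg Subtype.val this
  have h2 : t = 1 := by
    apply unit_eq_one_of_pow (ℓ := ℓ) (n := 1)
    obtain ⟨b, hb⟩ := aff_pow t 0 (ℓ ^ 1)
    rw [← hg, ← map_pow, pow_one, h1, map_one, ← aff_one_zero, aff_inj] at hb
    rw [pow_one]; exact hb.1.symm
  have h3 : g = 1 := hπ (by rw [hg, h2, aff_one_zero, map_one])
  subst h3
  have : orderOf (⟨1, t, hg⟩ : linearSubgroup π) = 1 := orderOf_eq_one_iff.2 rfl
  rw [this] at ho
  exact (Fact.out : ℓ.Prime).ne_one ho.symm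

theorem twist_apply_tz (π : Γ →* PGL(2, k)) (μ : Γ →* kˣ) {g : Γ} {t : kˣ} {a : k}
    (hg : π g = aff t a) (X : TraceZero k) :
    twist (adj.comp π) μ g X = (μ g : k) • tz (X.1 0 0 + t⁻¹ * a * X.1 1 0)
      (t * X.1 0 1 - 2 * a * X.1 0 0 - t⁻¹ * a ^ 2 * X.1 1 0) (t⁻¹ * X.1 1 0) := by
  conv_lhs => rw [traceZero_eq_tz X]
  rw [← adj_aff, ← hg]
  rfl

theorem coboundary_on_translations [DecidableEq k] (ℓ : ℕ) [Fact ℓ.Prime] [CharP k ℓ] [Finite Γ]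
    (h2 : (2 : k) ≠ 0) {π : Γ →* PGL(2, k)}
    (h : IsSharp π)
    (μ : Γ →* kˣ) (htr : ∀ g a, π g = aff 1 a → μ g = 1)
    {b : Γ} (hb : π b • (∞ : OnePoint k) = ∞) (hμb : μ b = -1) (c : Γ → TraceZero k)
    (hc : ∀ g h, c (g * h) = c g + twist (adj.comp π) μ g (c h)) :
    (∃ v, ∀ g a, π g = aff 1 a → c g = twist (adj.comp π) μ g v - v) ∨
      ((5 : k) = 0 ∧ ∀ t ∈ dil π, t ^ 4 = 1) := by
  obtain ⟨v₀, hv₀⟩ := exists_coboundary_on_of_card _ c hc (linearSubgroup π)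
    (card_linearSubgroup_ne_zero ℓ h.inj)
  have hc' := cocycle_sub_coboundary _ c hc v₀
  set c' : Γ → TraceZero k := fun g => c g - (twist (adj.comp π) μ g v₀ - v₀) with hc'def
  have hc0 : ∀ g t, π g = aff t 0 → c' g = 0 := fun g t hg => by
    simp only [hc'def]
    rw [hv₀ g ⟨t, hg⟩, sub_self]
  have hc' : ∀ g h, c' (g * h) = c' g + twist (adj.comp π) μ g (c' h) := hc'
  choose! u hu using fun a => (mem_transl (π := π) (a := a)).1
  choose! L hL using fun t (ht : t ∈ dil π) => h.exists_aff ht (zero_mem (transl π))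
  have hadd : ∀ a ∈ transl π, ∀ b ∈ transl π, c' (u (a + b)) = c' (u a) +
      tz ((c' (u b)).1 0 0 + a * (c' (u b)).1 1 0)
        ((c' (u b)).1 0 1 - 2 * a * (c' (u b)).1 0 0 - a ^ 2 * (c' (u b)).1 1 0)
        ((c' (u b)).1 1 0) := fun a ha b hb => by
    have : u (a + b) = u a * u b := h.inj (by
      rw [map_mul, hu _ ha, hu _ hb, hu _ (add_mem ha hb), aff_mul, aff_inj]
      simp [add_comm])
    rw [this, hc', twist_apply_tz π μ (hu a ha), htr _ _ (hu a ha)]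
    simp
  have hmul : ∀ t ∈ dil π, ∀ a ∈ transl π, c' (u (t * a)) =
      (μ (L t) : k) • tz ((c' (u a)).1 0 0) (t * (c' (u a)).1 0 1) (t⁻¹ * (c' (u a)).1 1 0) :=
      fun t ht a ha => by
    have e : L t * u a = u (t * a) * L t := h.inj (by
      rw [map_mul, map_mul, hu _ ha, hL _ ht, hu _ (dil_mul_mem_transl ht ha), aff_mul, aff_mul,
        aff_inj]
      simp)
    -- Evaluating on both sides of `e`, with the cocycle zero on linear maps, yields equivariance.
    have e2 := hc' (L t) (u a)
    rw [e, hc', hc0 _ _ (hL t ht), map_zero, add_zero, zero_add,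
      twist_apply_tz π μ (hL t ht)] at e2
    rw [e2]
    simp
  have hent : ∀ p q r : k, (tz p q r).1 0 0 = p ∧ (tz p q r).1 0 1 = q ∧
      (tz p q r).1 1 0 = r := fun p q r => by simp [tz]
  have key := translation_cocycle h2 (transl π) (dil π) h.one_mem h.exists_dil
    (fun t ht => h.dil_mem ht) (fun t => (μ (L t) : k))
    (fun t ht => by
      rw [← Units.val_pow_eq_pow_val, h.sq_char_eq_one μ (hL t ht), Units.val_one])
    (by
      obtain ⟨g, t, hg, hμg, ht⟩ := h.exists_linear_of_fix μ htr hb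
      refine ⟨t, ht, ?_⟩
      have : L t = g := h.inj (by rw [hL t ht, hg])
      simp [this, ← hμg, hμb])
    (fun a => (c' (u a)).1 0 0) (fun a => (c' (u a)).1 0 1) (fun a => (c' (u a)).1 1 0)
    (fun a ha b hb => by
      rw [hadd a ha b hb, Submodule.coe_add, Matrix.add_apply, (hent _ _ _).1, add_assoc])
    (fun a ha b hb => by
      rw [hadd a ha b hb, Submodule.coe_add, Matrix.add_apply, (hent _ _ _).2.1]
      ring)
    (fun t ht a ha => by
      rw [hmul t ht a ha, smul_tz, (hent _ _ _).2.2]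
      simp only [Units.val_inv_eq_inv_val]
      field_simp)
    (fun t ht a ha => by
      rw [hmul t ht a ha, smul_tz, (hent _ _ _).1])
    (fun t ht a ha => by
      rw [hmul t ht a ha, smul_tz, (hent _ _ _).2.1]
      ring)
  refine key.imp_left ?_
  rintro ⟨e, he⟩
  -- The lower-triangular matrix with entry e has coboundary (ae, -a²e, 0) on the translation by a.
  refine ⟨v₀ + tz 0 0 e, fun g a hg => ?_⟩
  have ha : a ∈ transl π := ⟨g, hg⟩
  have hgu : g = u a := h.inj (by rw [hg, hu a ha])
  have h3 : c' g = tz (a * e) (-(a ^ 2 * e)) 0 := by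
    rw [traceZero_eq_tz (c' g), hgu]
    rw [(he a ha).1, (he a ha).2.1, (he a ha).2.2]
  have h4 : twist (adj.comp π) μ g (tz 0 0 e) - tz 0 0 e = tz (a * e) (-(a ^ 2 * e)) 0 := by
    rw [twist_apply_tz π μ hg, htr g a hg, (hent _ _ _).1, (hent _ _ _).2.1, (hent _ _ _).2.2,
      Units.val_one, one_smul, tz_sub, tz_inj]
    simp
  rw [map_add]
  have h5 : c g = c' g + (twist (adj.comp π) μ g v₀ - v₀) := by simp [hc'def]
  rw [h5, h3, ← h4]
  abel

end Coboundary

/-! ### Recognition of PGL₂(𝔽₅). -/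

section PGLFive

variable {k : Type*} [Field k] [DecidableEq k] [CharP k 5] {Γ : Type*} [Group Γ]

instance factPrimeFive : Fact (Nat.Prime 5) := ⟨by norm_num⟩

theorem map_aff {F K : Type*} [Field F] [Field K] (ι : F →+* K) (t : Fˣ) (a : F) :
    ProjGenLinGroup.map ι (aff t a) = aff (Units.map ι t) (ι a) := by
  unfold aff
  rw [ProjGenLinGroup.map_mk]
  congr 1
  ext i j
  fin_cases i <;> fin_cases j <;> simp [GeneralLinearGroup.mkOfDetNeZero]

theorem map_inversion {F K : Type*} [Field F] [Field K] (ι : F →+* K) (c : Fˣ) :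
    ProjGenLinGroup.map ι (inversion c) = inversion (Units.map ι c) := by
  unfold inversion
  rw [ProjGenLinGroup.map_mk]
  congr 1
  ext i j
  fin_cases i <;> fin_cases j <;> simp [GeneralLinearGroup.mkOfDetNeZero]

theorem projMap_injective {F K : Type*} [Field F] [Field K] (ι : F →+* K) :
    Function.Injective (ProjGenLinGroup.map (n := Fin 2) ι) := by
  classical
  rw [injective_iff_map_eq_one]
  intro p hp
  induction p using ProjGenLinGroup.induction_on with | mk g =>
  rw [ProjGenLinGroup.map_mk, ← map_one ProjGenLinGroup.mk] at hp
  obtain ⟨z, hz, h⟩ := exists_smul_of_mk_eq_mk hp.symm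
  rw [← map_one ProjGenLinGroup.mk]
  refine mk_eq_mk_of_smul (g 0 0) ?_
  have h00 := congrFun (congrFun h 0) 0
  have h01 := congrFun (congrFun h 0) 1
  have h10 := congrFun (congrFun h 1) 0
  have h11 := congrFun (congrFun h 1) 1
  simp at h00 h01 h10 h11
  ext i j
  fin_cases i <;> fin_cases j <;> simp [h01, h10]
  exact ι.injective (h11.trans h00.symm)

/-- Every element of `PGL₂` over a field is affine or the product of two affine maps and an
inversion. -/
theorem mem_of_aff_of_inversion {F : Type*} [Field F] [DecidableEq F] (H : Subgroup PGL(2, F))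
    {c : Fˣ} (hc : inversion c ∈ H) (hH : ∀ t a, aff t a ∈ H) (p : PGL(2, F)) : p ∈ H := by
  by_cases hp : p • (∞ : OnePoint F) = ∞
  · obtain ⟨t, a, rfl⟩ := exists_eq_aff hp
    exact hH t a
  · obtain ⟨y, hy⟩ := OnePoint.ne_infty_iff_exists.1 hp
    have : (inversion c * aff 1 (-y) * p) • (∞ : OnePoint F) = ∞ := by
      rw [mul_smul, mul_smul, ← hy, aff_smul_coe]
      simp [inversion_smul_zero]
    obtain ⟨t, a, hta⟩ := exists_eq_aff this
    have h1 := H.mul_mem (H.inv_mem (H.mul_mem hc (hH 1 (-y)))) (hH t a)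
    rwa [← hta, inv_mul_cancel_left] at h1

/-- Fourth roots of unity in characteristic 5 lie in 𝔽₅, so A = 𝔽₅ and D = 𝔽₅ˣ. Affine maps over 𝔽₅
and one inversion generate both groups. -/
theorem nonempty_equiv_pgl_five {π : Γ →* PGL(2, k)} (h : IsSharp π)
    (h4 : ∀ t ∈ dil π, t ^ 4 = 1) : Nonempty (Γ ≃* PGL(2, ZMod 5)) := by
  set ι : ZMod 5 →+* k := ZMod.castHom (dvd_refl 5) k with hι
  have h5 : (5 : k) = 0 := by exact_mod_cast CharP.cast_eq_zero k 5
  have hA1 : ∀ z, ι z ∈ transl π := by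
    intro z
    have := nsmul_mem h.one_mem z.val
    rw [nsmul_one] at this
    have e : ((z.val : ℕ) : k) = ι z := by
      conv_rhs => rw [← ZMod.natCast_zmod_val z]
      rw [map_natCast]
    rwa [e] at this
  have hA2 : ∀ x ∈ transl π, ∃ z, ι z = x := by
    intro x hx
    by_cases hx0 : x = 0
    · exact ⟨0, by rw [hx0, map_zero]⟩
    · obtain ⟨t, ht, rfl⟩ := h.exists_dil x hx hx0
      have e : (t : k) ^ 4 = 1 := by
        rw [← Units.val_pow_eq_pow_val, h4 t ht, Units.val_one]
      -- Modulo 5 this product is t⁴ - 1.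
      have : ((t : k) - 1) * (t - 2) * (t - 3) * (t - 4) = 0 := by
        linear_combination e + (-2 * (t : k) ^ 3 + 7 * (t : k) ^ 2 - 10 * t + 5) * h5
      simp only [mul_eq_zero, sub_eq_zero] at this
      rcases this with ((h | h) | h) | h
      · exact ⟨1, by rw [h, map_one]⟩
      · exact ⟨2, by rw [h, map_ofNat]⟩
      · exact ⟨3, by rw [h, map_ofNat]⟩
      · exact ⟨4, by rw [h, map_ofNat]⟩
  have hU : ∀ t : kˣ, (t : k) ∈ transl π → ∃ z, Units.map (ι : ZMod 5 →* k) z = t := by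
    intro t ht
    obtain ⟨z, hz⟩ := hA2 _ ht
    have hz0 : z ≠ 0 := by
      rintro rfl
      rw [map_zero] at hz
      exact t.ne_zero hz.symm
    exact ⟨Units.mk0 z hz0, Units.ext hz⟩
  have hD : ∀ z : (ZMod 5)ˣ, Units.map (ι : ZMod 5 →* k) z ∈ dil π := by
    intro z
    obtain ⟨t, ht, e⟩ := h.exists_dil _ (hA1 z) (by simp)
    have : t = Units.map (ι : ZMod 5 →* k) z := Units.ext e
    rwa [← this]
  obtain ⟨w, c, hw⟩ := h.exists_inversion
  have hc : (c : k) ∈ transl π := h.smul_mem h.one_mem (g := w) (by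
    rw [hw, inversion_smul_coe c one_ne_zero, div_one])
  obtain ⟨c', rfl⟩ := hU c hc
  have haff : ∀ g, π g • (∞ : OnePoint k) = ∞ → π g ∈ (ProjGenLinGroup.map ι).range := by
    intro g hg
    obtain ⟨t, a, hta⟩ := exists_eq_aff hg
    obtain ⟨a', rfl⟩ := hA2 a (h.mem_of_aff hta)
    obtain ⟨t', rfl⟩ := hU t (h.dil_mem ⟨g, _, hta⟩)
    exact ⟨aff t' a', by rw [map_aff, hta]⟩
  have hrange : π.range = (ProjGenLinGroup.map (n := Fin 2) ι).range := by
    apply le_antisymm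
    · rintro _ ⟨g, rfl⟩
      by_cases hg : π g • (∞ : OnePoint k) = ∞
      · exact haff g hg
      · obtain ⟨y, hy⟩ := OnePoint.ne_infty_iff_exists.1 hg
        obtain ⟨u, hu⟩ := (h.orbit y).1 ⟨g, hy.symm⟩
        have h1 := haff (w * u⁻¹ * g) (by
          rw [map_mul, map_mul, mul_smul, mul_smul, ← hy, map_inv, hu, aff_inv, aff_smul_coe, hw]
          simp [inversion_smul_zero])
        have h2 := haff u (by rw [hu, aff_smul_infty])
        have h3 : π w ∈ (ProjGenLinGroup.map (n := Fin 2) ι).range :=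
          ⟨inversion c', by rw [map_inversion, hw]⟩
        have h4 := mul_mem (inv_mem (mul_mem h3 (inv_mem h2))) h1
        simpa [mul_assoc] using h4
    · rintro _ ⟨p, rfl⟩
      refine mem_of_aff_of_inversion (π.range.comap (ProjGenLinGroup.map ι)) (c := c') ?_ ?_ p
      · exact ⟨w, by rw [map_inversion, hw]⟩
      · intro t a
        obtain ⟨g, hg⟩ := h.exists_aff (hD t) (hA1 a)
        exact ⟨g, by rw [map_aff, hg]⟩
  exact ⟨(MonoidHom.ofInjective h.inj).trans ((MulEquiv.subgroupCongr hrange).trans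
    (MonoidHom.ofInjective (projMap_injective ι)).symm)⟩

end PGLFive

/-! ### Finite subgroups of PGL₂ without fixed point. -/

section Core

variable {k : Type*} [Field k] {Γ : Type*} [Group Γ]

/-- Every `1`-cocycle of `ad⁰ ⊗ μ` is a coboundary, or we are in the exceptional case. -/
def CoboundaryOrExceptional (ℓ : ℕ) (π : Γ →* PGL(2, k)) (μ : Γ →* kˣ) : Prop :=
  ∀ c : Γ → TraceZero k, (∀ g h, c (g * h) = c g + twist (adj.comp π) μ g (c h)) →
    (∃ v, ∀ g, c g = twist (adj.comp π) μ g v - v) ∨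
      (ℓ = 5 ∧ Nonempty (Γ ≃* PGL(2, ZMod 5)) ∧ ∀ g, μ g ^ 2 = 1)

/-- `adj p` intertwines the two coefficient modules; this allows any point to be placed at ∞. -/
theorem CoboundaryOrExceptional.of_conj {ℓ : ℕ} {π : Γ →* PGL(2, k)} {μ : Γ →* kˣ}
    (p : PGL(2, k)) (h : CoboundaryOrExceptional ℓ ((MulAut.conj p).toMonoidHom.comp π) μ) :
    CoboundaryOrExceptional ℓ π μ := by
  intro c hc
  have key : ∀ g X, twist (adj.comp ((MulAut.conj p).toMonoidHom.comp π)) μ g (adj p X) =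
      adj p (twist (adj.comp π) μ g X) := by
    intro g X
    have e : adj (p * π g * p⁻¹) (adj p X) = adj p (adj (π g) X) := by
      rw [← Module.End.mul_apply, ← map_mul, inv_mul_cancel_right, map_mul, Module.End.mul_apply]
    change (μ g : k) • adj (p * π g * p⁻¹) (adj p X) = adj p ((μ g : k) • adj (π g) X)
    rw [e, _root_.map_smul]
  have hp : ∀ X, adj p (adj p⁻¹ X) = X := fun X => by
    rw [← Module.End.mul_apply, ← map_mul, mul_inv_cancel, map_one, Module.End.one_apply]
  have hp' : ∀ X, adj p⁻¹ (adj p X) = X := fun X => by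
    rw [← Module.End.mul_apply, ← map_mul, inv_mul_cancel, map_one, Module.End.one_apply]
  refine (h (fun g => adj p (c g)) fun g h => by rw [key, hc, map_add]).imp_left ?_
  rintro ⟨v, hv⟩
  refine ⟨adj p⁻¹ v, fun g => ?_⟩
  have := congrArg (adj p⁻¹) (hv g)
  rw [hp', map_sub] at this
  rw [this]
  nth_rewrite 1 [← hp v]
  rw [key, hp']

variable {ℓ : ℕ} [Fact ℓ.Prime] [CharP k ℓ]

theorem translation_pow (a : k) (n : ℕ) : aff 1 a ^ n = aff 1 (n * a) := by
  induction n with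
  | zero => simp
  | succ n ih =>
    rw [pow_succ, ih, aff_mul, aff_inj]
    push_cast
    exact ⟨by simp, by simp; ring⟩

theorem char_translation (ℓ : ℕ) [Fact ℓ.Prime] [CharP k ℓ] {π : Γ →* PGL(2, k)}
    (hπ : Function.Injective π) (μ : Γ →* kˣ) {g : Γ} {a : k} (hg : π g = aff 1 a) : μ g = 1 := by
  have : g ^ ℓ = 1 := hπ (by
    rw [map_pow, hg, translation_pow, CharP.cast_eq_zero, zero_mul, aff_one_zero, map_one])
  apply unit_eq_one_of_pow (ℓ := ℓ) (n := 1)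
  rw [pow_one, ← map_pow, this, map_one]

variable [DecidableEq k] [Finite Γ]

theorem coboundaryOrExceptional_of_normalized (h2 : (2 : k) ≠ 0) {π : Γ →* PGL(2, k)}
    (hπ : Function.Injective π) (μ : Γ →* kˣ) {s : Γ} (hs : π s = aff (-1) 0) {u : Γ}
    (hu : π u = aff 1 1) (U : Sylow ℓ Γ) (hU : ∀ u ∈ U, π u • (∞ : OnePoint k) = ∞) {b : Γ}
    (hb : π b • (∞ : OnePoint k) = ∞) (hμb : μ b = -1)
    (hmove : ∃ g, π g • (∞ : OnePoint k) ≠ ∞)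
    (hF : ∀ g, ∃ b, π b • (∞ : OnePoint k) = ∞ ∧ μ g = μ b) :
    CoboundaryOrExceptional ℓ π μ := by
  intro c hc
  have htr : ∀ g a, π g = aff 1 a → μ g = 1 := fun g a hg => char_translation ℓ hπ μ hg
  have h1 : (1 : k) ∈ transl π := ⟨u, hu⟩
  obtain ⟨t, a, hta⟩ := exists_eq_aff hb
  have hne : μ b ≠ 1 := by
    rw [hμb]
    intro h
    have := congrArg Units.val h
    simp only [Units.val_neg, Units.val_one] at this
    exact h2 (by linear_combination -this)
  obtain ⟨horb, hcard⟩ := orbit_eq h2 π hπ μ hs h1 one_ne_zero htr hta hne hmove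
  have hsharp : IsSharp π := ⟨hπ, h1, horb, fun x hx hx0 => by
    obtain ⟨t, ht, e⟩ := exists_dil_mul_eq π h1 one_ne_zero hcard hx hx0
    exact ⟨t, ht, by rw [e, mul_one]⟩⟩
  rcases coboundary_on_translations ℓ h2 hsharp μ htr hb hμb c hc with ⟨v, hv⟩ | ⟨h5, h4⟩
  · left
    have hUtr : ∀ g ∈ U, ∃ a, π g = aff 1 a := by
      intro g hg
      obtain ⟨n, hn⟩ := U.isPGroup' ⟨g, hg⟩
      have hn : g ^ ℓ ^ n = 1 := congrArg Subtype.val hn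
      exact exists_translation_of_pow (n := n) (by rw [← map_pow, hn, map_one]) (hU g hg)
    obtain ⟨w, hw⟩ := exists_coboundary_of_vanish _
      (fun g => c g - (twist (adj.comp π) μ g v - v)) (cocycle_sub_coboundary _ c hc v)
      (U : Subgroup Γ) (fun g hg => by
        obtain ⟨a, ha⟩ := hUtr g hg
        simp only [hv g a ha, sub_self])
      (by rw [Ne, CharP.cast_eq_zero_iff k ℓ]; exact U.not_dvd_index)
    refine ⟨v + w, fun g => ?_⟩
    rw [map_add, add_sub_add_comm, ← hw g, add_sub_cancel]
  · right
    have hℓ : ℓ = 5 := by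
      have : ((5 : ℕ) : k) = 0 := by exact_mod_cast h5
      rw [CharP.cast_eq_zero_iff k ℓ] at this
      exact (Nat.prime_dvd_prime_iff_eq Fact.out (by norm_num)).1 this
    subst hℓ
    refine ⟨rfl, nonempty_equiv_pgl_five hsharp h4, fun g => ?_⟩
    obtain ⟨b, hb, e⟩ := hF g
    obtain ⟨b', t, hb', e', -⟩ := hsharp.exists_linear_of_fix μ htr hb
    rw [e, e', hsharp.sq_char_eq_one μ hb']

/-- An element fixing `∞` on which `μ` takes the value `-1` has a power of the form
`x ↦ -x + a`. -/
theorem exists_involution (h2 : (2 : k) ≠ 0) {π : Γ →* PGL(2, k)} (hπ : Function.Injective π)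
    (μ : Γ →* kˣ) {b : Γ} (hb : π b • (∞ : OnePoint k) = ∞) (hμb : μ b = -1) :
    ∃ s a, π s = aff (-1) a := by
  have hne : (-1 : kˣ) ≠ 1 := by
    intro h
    have := congrArg Units.val h
    simp only [Units.val_neg, Units.val_one] at this
    exact h2 (by linear_combination -this)
  have heven : Even (orderOf b) := by
    by_contra h
    rw [Nat.not_even_iff_odd] at h
    have := congrArg μ (pow_orderOf_eq_one b)
    rw [map_pow, hμb, h.neg_one_pow, map_one] at this
    exact hne this
  obtain ⟨d, hd⟩ := even_iff_exists_two_mul.1 heven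
  have hpos := orderOf_pos b
  have hs1 : b ^ d ≠ 1 := pow_ne_one_of_lt_orderOf (by omega) (by omega)
  have hs2 : b ^ d * b ^ d = 1 := by
    rw [← pow_add, ← two_mul, ← hd, pow_orderOf_eq_one]
  obtain ⟨t, a, hta⟩ := exists_eq_aff hb
  obtain ⟨a', ha'⟩ := aff_pow t a d
  rw [← hta, ← map_pow] at ha'
  have h3 := congrArg π hs2
  rw [map_mul, ha', aff_mul, map_one, ← aff_one_zero, aff_inj] at h3
  have h4 : ((t ^ d : kˣ) : k) * ((t ^ d : kˣ) : k) = 1 := by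
    rw [← Units.val_mul, h3.1, Units.val_one]
  rcases mul_self_eq_one_iff.1 h4 with h | h
  -- A power with linear part 1 would be a translation of order 2, impossible as 2 ≠ 0.
  · exfalso
    apply hs1
    apply hπ
    rw [ha', map_one, ← aff_one_zero, aff_inj]
    refine ⟨Units.ext h, ?_⟩
    have := h3.2
    rw [h] at this
    exact (mul_eq_zero.1 (show (2 : k) * a' = 0 by linear_combination this)).resolve_left h2
  · exact ⟨b ^ d, a', by rw [ha', aff_inj]; exact ⟨Units.ext (by simpa using h), rfl⟩⟩

theorem coboundaryOrExceptional_of_fix_infty (h2 : (2 : k) ≠ 0) {π : Γ →* PGL(2, k)}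
    (hπ : Function.Injective π) (μ : Γ →* kˣ) (hμ : ∃ g, μ g = -1) (U : Sylow ℓ Γ)
    (hU1 : Nontrivial U)
    (hU : ∀ u ∈ Subgroup.normalizer (U : Set Γ), π u • (∞ : OnePoint k) = ∞)
    (hmove : ∃ g, π g • (∞ : OnePoint k) ≠ ∞) : CoboundaryOrExceptional ℓ π μ := by
  have hF : ∀ g, ∃ b, π b • (∞ : OnePoint k) = ∞ ∧ μ g = μ b := fun g => by
    obtain ⟨b, hb, e⟩ := exists_mem_normalizer_char_eq μ U g
    exact ⟨b, hU b hb, e⟩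
  obtain ⟨g, hg⟩ := hμ
  obtain ⟨b, hb, e⟩ := hF g
  rw [hg] at e
  obtain ⟨s, a, hs⟩ := exists_involution h2 hπ μ hb e.symm
  have hUle : ∀ u ∈ U, π u • (∞ : OnePoint k) = ∞ := fun u hu => hU u (Subgroup.le_normalizer hu)
  obtain ⟨⟨u, huU⟩, hu1⟩ := exists_ne (1 : U)
  obtain ⟨n, hn⟩ := U.isPGroup' ⟨u, huU⟩
  have hn : u ^ ℓ ^ n = 1 := congrArg Subtype.val hn
  obtain ⟨a₁, ha₁⟩ := exists_translation_of_pow (n := n) (by rw [← map_pow, hn, map_one])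
    (hUle u huU)
  have ha₁0 : a₁ ≠ 0 := by
    rintro rfl
    apply hu1
    rw [aff_one_zero] at ha₁
    exact Subtype.ext (hπ (ha₁.trans (map_one π).symm))
  set t : kˣ := (Units.mk0 a₁ ha₁0)⁻¹ with ht
  have hta : (t : k) * a₁ = 1 := by simp [ht, ha₁0]
  -- This affine map carries the fixed point a/2 of s to 0 and rescales the translation a₁ to 1.
  refine CoboundaryOrExceptional.of_conj (aff t (-(t * a / 2))) ?_
  have hfix : ∀ g, ((MulAut.conj (aff t (-(t * a / 2)))).toMonoidHom.comp π) g •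
      (∞ : OnePoint k) = ∞ ↔ π g • (∞ : OnePoint k) = ∞ := by
    intro g
    change (aff t (-(t * a / 2)) * π g * (aff t (-(t * a / 2)))⁻¹) • (∞ : OnePoint k) = ∞ ↔ _
    rw [mul_smul, mul_smul, aff_inv, aff_smul_infty]
    conv_lhs => rw [← aff_smul_infty t (-(t * a / 2))]
    rw [aff_smul_infty, smul_eq_iff_eq_inv_smul, aff_inv, aff_smul_infty]
  refine coboundaryOrExceptional_of_normalized h2 ((MulAut.conj _).injective.comp hπ) μ (s := s)
    ?_ (u := u) ?_ U (fun u hu => (hfix u).2 (hUle u hu)) ((hfix b).2 hb) e.symm ?_ ?_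
  · change aff t (-(t * a / 2)) * π s * (aff t (-(t * a / 2)))⁻¹ = _
    rw [hs, aff_inv, aff_mul, aff_mul, aff_inj]
    refine ⟨by simp, ?_⟩
    simp
    field_simp
    ring
  · change aff t (-(t * a / 2)) * π u * (aff t (-(t * a / 2)))⁻¹ = _
    rw [ha₁, aff_conj_translation, hta]
  · obtain ⟨g, hg⟩ := hmove
    exact ⟨g, fun H => hg ((hfix g).1 H)⟩
  · intro g
    obtain ⟨b, hb, e⟩ := hF g
    exact ⟨b, (hfix b).2 hb, e⟩

/-- The main dichotomy for finite irreducible subgroups of `PGL₂(k)`. -/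
theorem coboundaryOrExceptional [IsAlgClosed k] (h2 : (2 : k) ≠ 0) {π : Γ →* PGL(2, k)}
    (hπ : Function.Injective π) (μ : Γ →* kˣ) (hμ : ∃ g, μ g = -1)
    (hmove : ∀ x : OnePoint k, ∃ g, π g • x ≠ x) : CoboundaryOrExceptional ℓ π μ := by
  let U : Sylow ℓ Γ := default
  rcases subsingleton_or_nontrivial U with hU | hU
  · intro c hc
    refine Or.inl (exists_coboundary_of_vanish _ c hc U (fun g hg => ?_)
      (by rw [Ne, CharP.cast_eq_zero_iff k ℓ]; exact U.not_dvd_index))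
    have : g = 1 := congrArg Subtype.val (Subsingleton.elim (⟨g, hg⟩ : U) 1)
    rw [this]
    exact cocycle_one _ c hc
  · obtain ⟨x, hx⟩ := exists_fixed_by_normalizer π hπ U hU
    obtain ⟨p, rfl⟩ := exists_smul_infty_eq x
    refine CoboundaryOrExceptional.of_conj p⁻¹ ?_
    have hfix : ∀ g, ((MulAut.conj p⁻¹).toMonoidHom.comp π) g •
        (∞ : OnePoint k) = ∞ ↔ π g • p • (∞ : OnePoint k) = p • (∞ : OnePoint k) := by
      intro g
      change (p⁻¹ * π g * p⁻¹⁻¹) • (∞ : OnePoint k) = ∞ ↔ _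
      rw [inv_inv, mul_smul, mul_smul, inv_smul_eq_iff]
    refine coboundaryOrExceptional_of_fix_infty h2 ((MulAut.conj _).injective.comp hπ) μ hμ U hU
      (fun u hu => (hfix u).2 (hx u hu)) ?_
    obtain ⟨g, hg⟩ := hmove (p • (∞ : OnePoint k))
    exact ⟨g, fun H => hg ((hfix g).1 H)⟩

end Core

/-! ### Passage from G/N to the projective image. -/

section Main

variable {k : Type} [Field k] {G : Type*} [Group G]

/-- A common fixed point is an invariant line: ∞ is spanned by (1, 0) and c by (c, 1). -/
theorem exists_move_of_isAbsolutelyIrreducible [DecidableEq k] {ρ : G →* GL (Fin 2) k}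
    (hρ : IsAbsolutelyIrreducible ρ) (x : OnePoint k) : ∃ g, projective ρ g • x ≠ x := by
  by_contra! H
  have := hρ k
  set τ := (Matrix.GeneralLinearGroup.map (algebraMap k k)).comp ρ with hτ
  have hτρ : ∀ g, τ g = ρ g := fun g => by
    ext i j
    simp [hτ]
  obtain ⟨v, w, hv, hw, hline⟩ : ∃ v w : Fin 2 → k, v ≠ 0 ∧ w ∉ Submodule.span k {v} ∧
      ∀ g, ∃ z : k, z • v = (ρ g : Matrix (Fin 2) (Fin 2) k) *ᵥ v := by
    cases x with
    | infty =>
      refine ⟨![1, 0], ![0, 1], fun h => by simpa using congrFun h 0, fun h => ?_, fun g => ?_⟩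
      · obtain ⟨z, hz⟩ := Submodule.mem_span_singleton.1 h
        simpa using congrFun hz 1
      · have h10 := H g
        change ρ g • (∞ : OnePoint k) = ∞ at h10
        rw [smul_infty_eq_self_iff] at h10
        refine ⟨ρ g 0 0, ?_⟩
        ext i
        fin_cases i <;> simp [h10]
    | coe c =>
      refine ⟨![c, 1], ![1, 0], fun h => by simpa using congrFun h 1, fun h => ?_, fun g => ?_⟩
      · obtain ⟨z, hz⟩ := Submodule.mem_span_singleton.1 h
        have h1 := congrFun hz 1
        have h0 := congrFun hz 0
        simp at h0 h1
        simp [h1] at h0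
      · have h10 := H g
        change ρ g • (c : OnePoint k) = c at h10
        rw [smul_some_eq_ite] at h10
        split_ifs at h10 with h
        · exact absurd h10.symm (OnePoint.coe_ne_infty c)
        · rw [OnePoint.coe_eq_coe, div_eq_iff h] at h10
          refine ⟨ρ g 1 0 * c + ρ g 1 1, ?_⟩
          ext i
          fin_cases i
          · simp [h10]; ring
          · simp
  let S : Subrepresentation (vecRep τ) :=
    { toSubmodule := Submodule.span k {v}
      apply_mem_toSubmodule := by
        intro g y hy
        obtain ⟨a, rfl⟩ := Submodule.mem_span_singleton.1 hy
        obtain ⟨z, hz⟩ := hline g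
        refine Submodule.mem_span_singleton.2 ⟨a * z, ?_⟩
        change _ = (τ g : Matrix (Fin 2) (Fin 2) k) *ᵥ (a • v)
        rw [hτρ, Matrix.mulVec_smul, ← hz, smul_smul] }
  rcases eq_bot_or_eq_top S with h | h
  · have h' : Submodule.span k {v} = ⊥ := congrArg Subrepresentation.toSubmodule h
    exact hv (Submodule.span_singleton_eq_bot.1 h')
  · have h' : Submodule.span k {v} = ⊤ := congrArg Subrepresentation.toSubmodule h
    exact hw (by rw [h']; trivial)

theorem adZero_eq_adj (ρ : G →* GL (Fin 2) k) (g : G) : adZero ρ g = adj (projective ρ g) := rfl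

theorem mem_kernel_of_projective {ρ : G →* GL (Fin 2) k} {μ : G →* kˣ} {g : G}
    (h : projective ρ g = 1) (hμ : μ g = 1) : g ∈ kernel ρ μ := by
  rw [kernel_eq]
  exact Subgroup.mem_inf.2 ⟨by rw [MonoidHom.mem_ker, adZero_eq_adj, h, map_one], hμ⟩

/-- Vanishing of `H¹` in terms of cocycles. -/
theorem subsingleton_H1 {k G : Type} [Field k] [Group G] (A : Rep k G)
    (h : ∀ c : G → A, (∀ g h, c (g * h) = c g + A.ρ g (c h)) → ∃ v, ∀ g, c g = A.ρ g v - v) :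
    Subsingleton (groupCohomology A 1) := by
  refine subsingleton_of_forall_eq 0 fun x => ?_
  induction x using groupCohomology.H1_induction_on with | h f =>
  rw [groupCohomology.H1π_eq_zero_iff]
  obtain ⟨v, hv⟩ := h f fun g h => by
    rw [(groupCohomology.mem_cocycles₁_iff (f : G → A)).1 f.2 g h, add_comm]
  exact ⟨v, funext fun g => (hv g).symm⟩

/-- A scalar on which `μ` is nontrivial acts by a nontrivial scalar on the coefficients and thus
kills the cohomology. -/
theorem exists_coboundary_of_scalar {ρ : G →* GL (Fin 2) k} {μ : G →* kˣ} {z : G}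
    (hz : projective ρ z = 1) (hμz : μ z ≠ 1) (c : G ⧸ kernel ρ μ → TraceZero k)
    (hc : ∀ g h, c (g * h) = c g + quotientRep ρ μ g (c h)) :
    ∃ v, ∀ g, c g = quotientRep ρ μ g v - v := by
  have hact : ∀ X, quotientRep ρ μ (z : G ⧸ kernel ρ μ) X = (μ z : k) • X := by
    intro X
    change (μ z : k) • adj (projective ρ z) X = _
    rw [hz, map_one, Module.End.one_apply]
  have hne : (μ z : k) - 1 ≠ 0 := by
    rw [sub_ne_zero]
    exact fun h => hμz (Units.ext h)
  refine ⟨((μ z : k) - 1)⁻¹ • c z, fun x => ?_⟩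
  have hcomm : (z : G ⧸ kernel ρ μ) * x = x * z := by
    induction x using QuotientGroup.induction_on with | H g =>
    rw [← QuotientGroup.mk_mul, ← QuotientGroup.mk_mul, QuotientGroup.eq]
    apply mem_kernel_of_projective
    · rw [map_mul, map_inv, map_mul, map_mul, hz]; simp
    · rw [map_mul, map_inv, map_mul, map_mul, mul_comm (μ z)]; simp
  -- Expanding c(zx) = c(xz) gives (μ(z) - 1)c(x) = x·c(z) - c(z).
  have h1 := hc z x
  rw [hcomm, hc, hact] at h1
  have h2 : ((μ z : k) - 1) • c x = quotientRep ρ μ x (c z) - c z := by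
    have h3 : ((μ z : k) - 1) • c x = (μ z : k) • c x - c x := by
      ext i j
      simp [_root_.sub_mul]
    rw [h3, sub_eq_sub_iff_add_eq_add, add_comm, ← h1, add_comm]
  have h3 : c x = ((μ z : k) - 1)⁻¹ • (quotientRep ρ μ x (c z) - c z) := by
    rw [← h2, smul_smul, inv_mul_cancel₀ hne, one_smul]
  rw [_root_.map_smul, h3]
  exact smul_sub _ _ _

/-- If scalars lie in the kernel of `μ`, cocycles of `G` descend to the projective image. -/
theorem exists_coboundary_of_projective [Finite G] {ℓ : ℕ} [Fact ℓ.Prime] [CharP k ℓ]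
    [IsAlgClosed k] (h2 : (2 : k) ≠ 0) {ρ : G →* GL (Fin 2) k} (hρ : IsAbsolutelyIrreducible ρ)
    {μ : G →* kˣ} (hμ : ∃ g, μ g = -1) (hz : ∀ z, projective ρ z = 1 → μ z = 1)
    (hex : ¬ IsExceptional ℓ ρ μ) (c : G ⧸ kernel ρ μ → TraceZero k)
    (hc : ∀ g h, c (g * h) = c g + quotientRep ρ μ g (c h)) :
    ∃ v, ∀ g, c g = quotientRep ρ μ g v - v := by
  classical
  have hμ_eq : ∀ g h, projective ρ g = projective ρ h → μ g = μ h := by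
    intro g h e
    have := hz (g⁻¹ * h) (by rw [map_mul, map_inv, e, inv_mul_cancel])
    rwa [map_mul, map_inv, inv_mul_eq_one] at this
  have hmk_eq : ∀ g h, projective ρ g = projective ρ h →
      (g : G ⧸ kernel ρ μ) = (h : G ⧸ kernel ρ μ) := by
    intro g h e
    have e' : projective ρ (g⁻¹ * h) = 1 := by rw [map_mul, map_inv, e, inv_mul_cancel]
    exact QuotientGroup.eq.2 (mem_kernel_of_projective e' (hz _ e'))
  -- A set-theoretic section suffices: μ and the class modulo N depend only on the projective image.
  choose r hr using fun γ : (projective ρ).range => γ.2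
  have hr_mul : ∀ γ δ, projective ρ (r (γ * δ)) = projective ρ (r γ * r δ) := fun γ δ => by
    rw [hr, map_mul, hr, hr]; rfl
  let μ' : (projective ρ).range →* kˣ :=
    { toFun := fun γ => μ (r γ)
      map_one' := hz _ (hr 1)
      map_mul' := fun γ δ => by rw [hμ_eq _ _ (hr_mul γ δ), map_mul] }
  have hμ' : ∀ g, μ' ((projective ρ).rangeRestrict g) = μ g := fun g =>
    hμ_eq _ _ (hr ((projective ρ).rangeRestrict g))
  have hμ'neg : ∃ γ, μ' γ = -1 := by
    obtain ⟨g, hg⟩ := hμ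
    exact ⟨_, (hμ' g).trans hg⟩
  have : Finite (projective ρ).range :=
    Finite.of_surjective _ (projective ρ).rangeRestrict_surjective
  have hmove : ∀ x : OnePoint k, ∃ γ, (projective ρ).range.subtype γ • x ≠ x := fun x => by
    obtain ⟨g, hg⟩ := exists_move_of_isAbsolutelyIrreducible hρ x
    exact ⟨(projective ρ).rangeRestrict g, hg⟩
  have hrep : ∀ γ X, twist (adj.comp (projective ρ).range.subtype) μ' γ X =
      quotientRep ρ μ (r γ : G ⧸ kernel ρ μ) X := by
    intro γ X
    change (μ (r γ) : k) • adj (γ : PGL(2, k)) X = (μ (r γ) : k) • adj (projective ρ (r γ)) X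
    rw [hr]
  rcases coboundaryOrExceptional (ℓ := ℓ) h2 (projective ρ).range.subtype_injective μ' hμ'neg
    hmove (fun γ => c (r γ)) (fun γ δ => by
      rw [hmk_eq _ _ (hr_mul γ δ), QuotientGroup.mk_mul, hc, hrep]) with ⟨v, hv⟩ | ⟨hℓ, ⟨e⟩, hsq⟩
  · refine ⟨v, fun x => ?_⟩
    induction x using QuotientGroup.induction_on with | H g =>
    have h1 := hv ((projective ρ).rangeRestrict g)
    rw [hrep] at h1
    have h3 := hmk_eq _ _ (hr ((projective ρ).rangeRestrict g))
    rwa [h3] at h1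
  · refine absurd ⟨hℓ, e, μ'.comp e.symm.toMonoidHom, ?_, fun g => ?_⟩ hex
    · refine orderOf_eq_prime (MonoidHom.ext fun p => hsq (e.symm p)) fun h => ?_
      obtain ⟨γ, hγ⟩ := hμ'neg
      have h3 : μ' (e.symm (e γ)) = 1 := DFunLike.congr_fun h (e γ)
      rw [e.symm_apply_apply, hγ] at h3
      have := congrArg Units.val h3
      simp only [Units.val_neg, Units.val_one] at this
      exact h2 (by linear_combination -this)
    · rw [← hμ' g]
      change _ = μ' (e.symm (e _))
      rw [e.symm_apply_apply]

end Main

end AdjointH1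

end

theorem mainTheorem11 (ℓ : ℕ) [Fact ℓ.Prime] (hℓ : ℓ ≠ 2) {G : Type} [Group G] [Finite G]
    (ρ : G →* Matrix.GeneralLinearGroup (Fin 2) (AlgebraicClosure (ZMod ℓ)))
    (hρ : AdjointH1.IsAbsolutelyIrreducible ρ)
    (μ : G →* (AlgebraicClosure (ZMod ℓ))ˣ) (hμ : Even (orderOf μ))
    (hex : ¬ AdjointH1.IsExceptional ℓ ρ μ) :
    Subsingleton (groupCohomology (Rep.of (AdjointH1.quotientRep ρ μ)) 1) := by
  have h2 : (2 : AlgebraicClosure (ZMod ℓ)) ≠ 0 := by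
    intro h
    have : ((2 : ℕ) : AlgebraicClosure (ZMod ℓ)) = 0 := by exact_mod_cast h
    rw [CharP.cast_eq_zero_iff _ ℓ] at this
    exact hℓ ((Nat.prime_dvd_prime_iff_eq Fact.out Nat.prime_two).1 this)
  refine AdjointH1.subsingleton_H1 (Rep.of (AdjointH1.quotientRep ρ μ)) fun c hc => ?_
  by_cases hz : ∀ z, AdjointH1.projective ρ z = 1 → μ z = 1
  · exact AdjointH1.exists_coboundary_of_projective (ℓ := ℓ) h2 hρ
      (AdjointH1.exists_char_eq_neg_one μ hμ) hz hex c hc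
  · push Not at hz
    obtain ⟨z, hz, hμz⟩ := hz
    exact AdjointH1.exists_coboundary_of_scalar hz hμz c hc
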